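/- **Setting.** Let $n,p\ge 0$, $r\ge 1$ be integers, $\mathbf X\in\mathbb R^{n\times p}$, and for each random effect $i=1,\dots,r$ let $l_i$ be its number of levels and $(v_{i,j,k})$ ($1\le j\le l_i$, $1\le k\le n$) its real design matrix; effect $r$ is the error: $l_r=n$ and $v_{r,j,k}=1$ if $j=k$, $0$ otherwise. Let $a_k<b_k$ ($k=1,\dots,n$) be the data intervals. The interval-data structural equations are $$a_k < X_k\beta+\sum_{i=1}^r\sigma_i\sum_{j=1}^{l_i} v_{i,j,k}z_{i,j}\le b_k,\qquad k=1,\dots,n. \tag{1}$$ $Z_{1:t}$ is the vector of the $z_{i,j}$ occurring in one of the equations $1,\dots,t$ (i.e. with some $v_{i,j,k}\ne0$, $k\le t$), $Z_t$ the part of it occurring for the first time in equation $t$, and $z_{t,r}$ the error component of equation $t$. $Q_t(Z_{1:t})$ is the set of $(\beta,\sigma)\in\mathbb R^p\times\mathbb R^r$ satisfying the first $t$ equations and $\mathbf C_t=\{Z_{1:t}: Q_t(Z_{1:t})\neq\varnothing\}$. The generalized fiducial target $\pi_{1:t}$ has density proportional to $\exp(-Z_{1:t}^TZ_{1:t}/2)\,\mathbf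 1_{\mathbf C_t}(Z_{1:t})$. **Algorithm.** Start with $N$ particles of weight $1$. For $t=1,\dots,n$: 1. *Sampling.* Independently for each particle, draw the non-error components of $Z_t$ from $N(0,1)$. Then draw $z_{t,r}$ from $N(0,1)$ if $t\le p+r$, and from the standard Cauchy law truncated to $(m_t,M_t)$ if $t>p+r$, where $m_t,M_t\in[-\infty,\infty]$ are the infimum and supremum of the values of $z_{t,r}$ for which some $(\beta,\sigma)\in Q_{t-1}$ satisfies the $t$-th equation. (If $(m_t,M_t)$ has Cauchy mass zero, the untruncated law is used; the particle then gets weight zero.) 2. *Reweighting.* Multiply the weight by the ratio of $\pi_{1:t}/\widetilde\pi_{1:t}$ to $\pi_{1:t-1}/\widetilde\pi_{1:t-1}$, where $\widetilde\pi_{1:t}$ is the proposal density, i.e. up to a constant by $\mathbf 1_{\mathbf C_t}(Z_{1:t})$ if $t\le p+r$ and by $\mathbf 1_{\mathbf C_t}(Z_{1:t})\,e^{-z_{t,r}^2/2}(1+z_{t,r}^2)\,(F(M_t)-F(m_t))$ if $t>p+r$, with $F$ the standard Cauchy distribution function (the last difference is $0$ if $(m_t,M_t)$ is empty). 3. *Resampling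 and alteration.* If $t$ is one of the pre-specified times in a set $S$, or the effective sample size $(\sum_J W^{(J)})^2/\sum_J (W^{(J)})^2$ is below a threshold $T_{t,N}$ (and not all weights are zero), draw $N$ particles independently from the current ones with probabilities proportional to the weights, and set all weights to $1$. Then, independently for each particle, alter its effects $e=1,\dots,r$ one after the other: let $Z$ be the current vector of those $z_{e,j}$ that occur in equations $1,\dots,t$, let $\mathbf V$ be the corresponding design matrix (rows $1,\dots,t$), let $\mathbf X'$ be the matrix with the columns of $\mathbf X$ and the columns $\sum_j V_{i,j}z_{i,j}$, $i\ne e$ (rows $1,\dots,t$), let $\Pi$ be the orthogonal projection onto $\{\eta_2:\ \mathbf V\eta_2=\mathbf X'\eta_1\text{ for some }\eta_1\}$ and $\tau=(Z-\Pi Z)/\|Z-\Pi Z\|$ ($\tau=0$ if $Z=\Pi Z$); replace $Z$ by $\Pi G+\|G-\Pi G\|\,\tau$ with a fresh standard normal vector $G$. **Theorem.** Whatever the set $S$ and the real thresholds $T_{t,N}$, the law $\pi_{1:n}$ is a well-defined probability measure, the algorithm defines for each $N$ a probability law of the weighted particle system $\{Z_{1:n}^{(J)},W_{1:n}^{(J)}\}_{J=1}^N$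 after step $n$, and for every bounded measurable $f$, as $N\to\infty$, $$\Bigl(\sum_{I=1}^N W_{1:n}^{(I)}\Bigr)^{-1}\sum_{J=1}^N f\bigl(Z_{1:n}^{(J)}\bigr)W_{1:n}^{(J)}\ \stackrel{P}{\longrightarrow}\ \int f\,d\pi_{1:n}.$$ -/

import Mathlib

open MeasureTheory ProbabilityTheory Filter Topology
open scoped NNReal ENNReal Classical

noncomputable section

/-- A normal linear mixed model with interval data.  There are `n` data, `p` fixed effects and
`r = q + 1` random effects; the last random effect is the error.
The structural equations are
`a k < (X β) k + ∑ i, σ i * ∑ j, V i k j * z i j ≤ b k`, one for each datum `k`. -/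
structure IntervalLMM (n p q : ℕ) where
  /-- fixed-effects design matrix -/
  X : Matrix (Fin n) (Fin p) ℝ
  /-- number of levels of each random effect -/
  l : Fin (q + 1) → ℕ
  /-- design matrices of the random effects: `V i k j` belongs to effect `i`, datum `k`, level `j` -/
  V : (i : Fin (q + 1)) → Matrix (Fin n) (Fin (l i)) ℝ
  /-- lower end points of the data intervals -/
  a : Fin n → ℝ
  /-- upper end points of the data intervals -/
  b : Fin n → ℝ
  a_lt_b : ∀ k, a k < b k
  /-- the error effect has one level per datum ... -/
  l_error : l (Fin.last q) = n
  /-- ... and its design matrix is the identity -/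
  V_error : ∀ k j, V (Fin.last q) k j = if (k : ℕ) = (j : ℕ) then 1 else 0

namespace IntervalLMM

variable {n p q : ℕ} (M : IntervalLMM n p q)

/-- A vector of all random components `z i j`.  The vector `Z_{1:t}` of the components that occur
in the first `t` data is identified with its extension by zero. -/
abbrev State : Type := (i : Fin (q + 1)) → Fin (M.l i) → ℝ

/-- The parameters `(β, σ)`. -/
abbrev Param (_M : IntervalLMM n p q) : Type := (Fin p → ℝ) × (Fin (q + 1) → ℝ)

/-- `X_k β + ∑ i, σ_i ∑ j, v_{i,j,k} z_{i,j}`. -/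
def fit (θ : M.Param) (z : M.State) (k : Fin n) : ℝ :=
  ∑ c, M.X k c * θ.1 c + ∑ i, θ.2 i * ∑ j, M.V i k j * z i j

/-- `Q_t(z)`: the parameters that satisfy the first `t` structural equations. -/
def Q (t : ℕ) (z : M.State) : Set M.Param :=
  {θ | ∀ k : Fin n, (k : ℕ) < t → M.a k < M.fit θ z k ∧ M.fit θ z k ≤ M.b k}

/-- `C_t`: the random components for which `Q_t` is not empty. -/
def C (t : ℕ) : Set M.State := {z | (M.Q t z).Nonempty}

/-- The component `z i j` occurs in one of the first `t` data. -/
def Introduced (t : ℕ) (i : Fin (q + 1)) (j : Fin (M.l i)) : Prop :=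
  ∃ k : Fin n, (k : ℕ) < t ∧ M.V i k j ≠ 0

/-- The standard normal law of the components `z i j`, `j = 1, …, l i`, of one effect that occur in
the first `t` data (the others are zero). -/
def gaussEffect (t : ℕ) (i : Fin (q + 1)) : Measure (Fin (M.l i) → ℝ) :=
  Measure.pi fun j => if M.Introduced t i j then gaussianReal 0 1 else Measure.dirac 0

/-- The generalized fiducial target `π_{1:t}`, with density proportional to
`exp (- Zᵀ Z / 2) * 1_{C_t} (Z)`: the standard normal law conditioned on `C_t`. -/
def target (t : ℕ) : Measure M.State :=
  (Measure.pi fun i => M.gaussEffect t i)[|M.C t]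

/-! ### Sampling step -/

/-- The standard Cauchy distribution. -/
def stdCauchy : Measure ℝ := cauchyMeasure 0 1

/-- The standard Cauchy distribution truncated to `A`.  If `A` has mass zero (in the algorithm: a
particle of weight zero) the truncation is not defined and the untruncated law is used. -/
def truncCauchy (A : Set ℝ) : Measure ℝ :=
  if stdCauchy A = 0 then stdCauchy else stdCauchy[|A]

/-- The level of the error effect that belongs to datum `k`. -/
def errLevel (k : Fin n) : Fin (M.l (Fin.last q)) := Fin.cast M.l_error.symm k

/-- Replace the error component of datum `k` by `x`. -/
def setErr (k : Fin n) (z : M.State) (x : ℝ) : M.State :=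
  Function.update z (Fin.last q) (Function.update (z (Fin.last q)) (M.errLevel k) x)

/-- The possible values of the error component of datum `k`, given the previous components and the
other components of datum `k`: some `(β, σ)` in the current `Q` satisfies the structural equation
of datum `k`. -/
def feasibleErr (k : Fin n) (z : M.State) : Set ℝ :=
  {x | ∃ θ ∈ M.Q k z, M.a k < M.fit θ (M.setErr k z x) k ∧ M.fit θ (M.setErr k z x) k ≤ M.b k}

/-- `m_t`: the least possible value of the error component (possibly infinite). -/
def lower (k : Fin n) (z : M.State) : EReal := sInf ((fun x : ℝ => (x : EReal)) '' M.feasibleErr k z)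

/-- `M_t`: the largest possible value of the error component (possibly infinite). -/
def upper (k : Fin n) (z : M.State) : EReal := sSup ((fun x : ℝ => (x : EReal)) '' M.feasibleErr k z)

/-- The interval `(m_t, M_t)`. -/
def interval (k : Fin n) (z : M.State) : Set ℝ :=
  {x | M.lower k z < (x : EReal) ∧ (x : EReal) < M.upper k z}

/-- Datum `k` comes at time `t = k + 1`; the truncated Cauchy proposal is used for `t > p + r`. -/
def Late (_M : IntervalLMM n p q) (k : Fin n) : Prop := p + (q + 1) < (k : ℕ) + 1

/-- The proposal for the error component of datum `k`. -/
def errProposal (k : Fin n) (z : M.State) : Measure ℝ :=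
  if M.Late k then truncCauchy (M.interval k z) else gaussianReal 0 1

/-- The non-error components that first occur in datum `k` are drawn from `N(0,1)`; all the other
components are kept. -/
def nonErrProposal (k : Fin n) (z : M.State) : Measure M.State :=
  Measure.pi fun i => Measure.pi fun j =>
    if i ≠ Fin.last q ∧ M.Introduced (k + 1) i j ∧ ¬ M.Introduced k i j then gaussianReal 0 1
    else Measure.dirac (z i j)

/-- The proposal at datum `k`: first the new non-error components, then the error component. -/
def proposal (k : Fin n) (z : M.State) : Measure M.State :=
  (M.nonErrProposal k z).bind fun z' => (M.errProposal k z').map (M.setErr k z')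

/-- The updating factor of the weight at datum `k`, i.e. the ratio of `π_{1:t} / π̃_{1:t}` and
`π_{1:t-1} / π̃_{1:t-1}` up to a constant factor, with `t = k + 1`:
`1_{C_t} * exp (- z² / 2) * (1 + z²) * (F(M_t) - F(m_t))` with `z` the error component of datum `k`
if `t > p + r`, and `1_{C_t}` otherwise. -/
def weightFactor (k : Fin n) (z : M.State) : ℝ≥0 :=
  if z ∈ M.C (k + 1) then
    if M.Late k then
      Real.toNNReal (Real.exp (-(z (Fin.last q) (M.errLevel k)) ^ 2 / 2)
        * (1 + (z (Fin.last q) (M.errLevel k)) ^ 2) * (stdCauchy (M.interval k z)).toReal)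
    else 1
  else 0

/-! ### Alteration step -/

/-- For the effect `e` and the first `t` data, let `X'` be the matrix with the columns of `X` and
the columns `∑ j, V_{i,j} z_{i,j}`, `i ≠ e`, and let `V = V_e`.  This is the space of all `η₂` such
that `(η₁, η₂)` is in the null space of `[-X', V]` for some `η₁`. -/
def nullSpace (t : ℕ) (e : Fin (q + 1)) (z : M.State) :
    Submodule ℝ (EuclideanSpace ℝ (Fin (M.l e))) where
  carrier := {v | (∀ j, ¬ M.Introduced t e j → v j = 0) ∧
    ∃ (β : Fin p → ℝ) (s : Fin (q + 1) → ℝ), ∀ k : Fin n, (k : ℕ) < t →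
      ∑ j, M.V e k j * v j =
        ∑ c, M.X k c * β c + ∑ i ∈ Finset.univ.erase e, s i * ∑ j, M.V i k j * z i j}
  zero_mem' := ⟨fun _ _ => rfl, 0, 0, fun k _ => by simp⟩
  add_mem' := by
    rintro v w ⟨hv, β, s, h⟩ ⟨hw, β', s', h'⟩
    refine ⟨fun j hj => by simp [hv j hj, hw j hj], β + β', s + s', fun k hk => ?_⟩
    simp only [PiLp.add_apply, Pi.add_apply, mul_add, add_mul, Finset.sum_add_distrib, h k hk,
      h' k hk]
    ring
  smul_mem' := by
    rintro c v ⟨hv, β, s, h⟩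
    refine ⟨fun j hj => by simp [hv j hj], c • β, c • s, fun k hk => ?_⟩
    have h1 := congrArg (fun y => c * y) (h k hk)
    simp only [mul_add, Finset.mul_sum] at h1
    simp only [PiLp.smul_apply, Pi.smul_apply, smul_eq_mul, Finset.mul_sum]
    simpa only [mul_left_comm, mul_assoc] using h1

/-- `Π v`, the orthogonal projection of `v` onto the space above. -/
def proj (t : ℕ) (e : Fin (q + 1)) (z : M.State) (v : EuclideanSpace ℝ (Fin (M.l e))) :
    EuclideanSpace ℝ (Fin (M.l e)) :=
  (M.nullSpace t e z).starProjection v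

/-- The altered components `η₂ C̃ + D̃ τ` of the effect `e`.  Here
`τ = (Z - Π Z) / ‖Z - Π Z‖` for the components `Z` of the selected particle, and
`η₂ C̃ = Π g`, `D̃ = ‖g - Π g‖` come from the same decomposition of a vector `g`. -/
def alterVec (t : ℕ) (e : Fin (q + 1)) (z : M.State) (g : Fin (M.l e) → ℝ) : Fin (M.l e) → ℝ :=
  let Z : EuclideanSpace ℝ (Fin (M.l e)) := WithLp.toLp 2 (z e)
  let G : EuclideanSpace ℝ (Fin (M.l e)) := WithLp.toLp 2 g
  let τ := ‖Z - M.proj t e z Z‖⁻¹ • (Z - M.proj t e z Z)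
  WithLp.ofLp (M.proj t e z G + ‖G - M.proj t e z G‖ • τ)

/-- The alteration of the effect `e` at time `t`: `(C̃, D̃)` has the law of `(C, D)` for a standard
normal vector (so `C̃` is standard normal of the dimension of the space and `D̃` is an independent
chi variable with the complementary number of degrees of freedom). -/
def alterEffect (t : ℕ) (e : Fin (q + 1)) (z : M.State) : Measure M.State :=
  (M.gaussEffect t e).map fun g => Function.update z e (M.alterVec t e z g)

/-- The alteration of a particle: one effect after the other. -/
def alter (t : ℕ) (z : M.State) : Measure M.State :=
  (List.finRange (q + 1)).foldl (fun μ e => μ.bind (M.alterEffect t e)) (Measure.dirac z)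

/-! ### The particle system -/

/-- A system of `N` weighted particles `(Z^(J), W^(J))`. -/
abbrev Particles (N : ℕ) : Type := Fin N → M.State × ℝ≥0

variable {M} in
/-- The sum of the weights. -/
def totalWeight {N : ℕ} (s : M.Particles N) : ℝ≥0 := ∑ J, (s J).2

variable {M} in
/-- The effective sample size `(∑ W)² / ∑ W²`. -/
def ess {N : ℕ} (s : M.Particles N) : ℝ≥0 := totalWeight s ^ 2 / ∑ J, (s J).2 ^ 2

variable {M} in
/-- The self-normalized weighted average of `f`. -/
def weightedAverage {N : ℕ} (f : M.State → ℝ) (s : M.Particles N) : ℝ :=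
  (∑ I, ((s I).2 : ℝ))⁻¹ * ∑ J, f (s J).1 * ((s J).2 : ℝ)

/-- Sampling and reweighting at datum `k`, independently for the particles. -/
def sampleStep (k : Fin n) {N : ℕ} (s : M.Particles N) : Measure (M.Particles N) :=
  Measure.pi fun J => (M.proposal k (s J).1).map fun z => (z, (s J).2 * M.weightFactor k z)

/-- Multinomial resampling: `N` independent draws from the particles with probabilities
proportional to the weights; the new weights are equal to one. -/
def multinomial {N : ℕ} (s : M.Particles N) : Measure (M.Particles N) :=
  Measure.pi fun _ => ∑ J, (((s J).2 / totalWeight s : ℝ≥0) : ℝ≥0∞) • Measure.dirac ((s J).1, 1)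

/-- The alteration at time `t`, independently for the particles. -/
def alterStep (t : ℕ) {N : ℕ} (s : M.Particles N) : Measure (M.Particles N) :=
  Measure.pi fun J => (M.alter t (s J).1).map fun z => (z, (s J).2)

/-- Resampling and alteration at time `t`, performed if `t` is one of the pre-specified times in `S`
or the effective sample size is below the threshold `T` (and the weights do not all vanish). -/
def resampleStep (S : Set ℕ) (T : ℝ) (t : ℕ) {N : ℕ} (s : M.Particles N) :
    Measure (M.Particles N) :=
  if totalWeight s ≠ 0 ∧ (t ∈ S ∨ (ess s : ℝ) < T) then (M.multinomial s).bind (M.alterStep t)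
  else Measure.dirac s

/-- The law of the system of `N` particles after the algorithm has processed the first `t` data.
`S` is the set of pre-specified resampling times, `T t N` the threshold for the effective sample
size at time `t`. -/
def smcLaw (S : Set ℕ) (T : ℕ → ℕ → ℝ) (N : ℕ) : ℕ → Measure (M.Particles N)
  | 0 => Measure.dirac fun _ => (0, 1)
  | t + 1 =>
    if h : t < n then
      ((smcLaw S T N t).bind (M.sampleStep ⟨t, h⟩)).bind
        (M.resampleStep S (T (t + 1) N) (t + 1))
    else smcLaw S T N t

end IntervalLMM

end

/-! Let `γ_t` be `unnormTarget t`: the Gaussian law of the components introduced by time `t`,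
restricted to `C t`. The theorem rests on two exact identities and a law of large numbers.

Reweighted proposal (`withDensity_unnormTarget_bind_proposal`). Drawing from the proposal and
multiplying by the weight factor turns `γ_(t-1)` into a constant multiple of `γ_t`. The weight
factor replaces the truncated Cauchy density by the Gaussian one, and truncating to `(m_t, M_t)`
loses at most the two end points, a null set. The factor is bounded by 2.

Alteration (`unnormTarget_bind_alter`). It leaves `γ_t` invariant. Off the null space, a Gaussian
vector has a uniform direction, independent of its length and of its projection, so refreshing the
latter two keeps the Gaussian law (`map_projection_add_norm_smul_unitDir`). The new vector is almost
surely a nonzero multiple of the old one plus a null vector, which a change of `(β, σ)` absorbs, so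
membership in `C t` is preserved (`update_mem_C_of_eq_smul_add`).

Law of large numbers. Resampling is triggered by a random effective sample size and an arbitrary
threshold, so the decision need not stabilise and the total weight divided by `N` need not converge.
The induction hypothesis `IsConsistent` is therefore insensitive to the scale of the weights: they
are bounded, their total is at least `δ N` with high probability, and weighted sums of `γ_t`-centred
functions are `o(N)` in probability. Given the current system, the particles are independent after a
move, and after resampling and moving; Chebyshev's inequality carries the hypothesis through both
steps, on whichever branch is taken.

Measurability of `C t`, of the truncation intervals and of the projections comes from one fact: the
relevant sets are images, along a σ-compact factor, of countable unions of closed sets. -/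

/-! ### Product measures and composition of kernels -/

section Measures

variable {α β γ ι : Type*} [MeasurableSpace α] [MeasurableSpace β] [MeasurableSpace γ]

theorem measurable_measure_map_uncurry {κ : α → Measure β} [∀ a, IsProbabilityMeasure (κ a)]
    (hκ : Measurable κ) {F : α → β → γ} (hF : Measurable (Function.uncurry F)) :
    Measurable fun a => (κ a).map (F a) := by
  refine Measure.measurable_of_measurable_coe _ fun s hs => ?_
  have hFa : ∀ a, Measurable (F a) := fun a => hF.comp measurable_prodMk_left
  simp only [Measure.map_apply (hFa _) hs]
  let η : Kernel α β := ⟨κ, hκ⟩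
  have : IsMarkovKernel η := ⟨fun a => inferInstanceAs (IsProbabilityMeasure (κ a))⟩
  exact Kernel.measurable_kernel_prodMk_left (κ := η) (hF hs)

theorem measurable_measure_map_const {μ : Measure β} [IsProbabilityMeasure μ] {F : α → β → γ}
    (hF : Measurable (Function.uncurry F)) : Measurable fun a => μ.map (F a) :=
  measurable_measure_map_uncurry measurable_const hF

variable [Fintype ι] {X Y : ι → Type*} [∀ i, MeasurableSpace (X i)] [∀ i, MeasurableSpace (Y i)]

theorem measurable_measure_pi {κ : (i : ι) → α → Measure (X i)}
    [hfin : ∀ i a, IsFiniteMeasure (κ i a)]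
    (hκ : ∀ i, Measurable (κ i)) : Measurable fun a => Measure.pi fun i => κ i a := by
  refine Measurable.measure_of_isPiSystem generateFrom_pi.symm isPiSystem_pi ?_ ?_
  · rintro _ ⟨s, hs, rfl⟩
    simp only [Measure.pi_pi]
    exact Finset.measurable_prod _ fun i _ =>
      (Measure.measurable_coe (hs i (Set.mem_univ i))).comp (hκ i)
  · simp only [Measure.pi_univ]
    exact Finset.measurable_prod _ fun i _ => (Measure.measurable_coe .univ).comp (hκ i)

theorem lintegral_pi_prod {μ : (i : ι) → Measure (X i)} [∀ i, IsProbabilityMeasure (μ i)]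
    {f : (i : ι) → X i → ℝ≥0∞} (hf : ∀ i, Measurable (f i)) :
    ∫⁻ x, ∏ i, f i (x i) ∂Measure.pi μ = ∏ i, ∫⁻ x, f i x ∂μ i := by
  have hm : ∀ i, Measurable fun x : (i : ι) → X i => f i (x i) := fun i =>
    (hf i).comp (measurable_pi_apply i)
  have h := lintegral_prod_eq_prod_lintegral_of_indepFun (μ := Measure.pi μ) Finset.univ
    (fun i x => f i (x i)) (iIndepFun_pi fun i => (hf i).aemeasurable) hm
  rw [h]
  refine Finset.prod_congr rfl fun i _ => ?_
  rw [← (measurePreserving_eval μ i).lintegral_comp (hf i)]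

theorem Measure.pi_bind_pi {μ : (i : ι) → Measure (X i)} [∀ i, IsProbabilityMeasure (μ i)]
    {κ : (i : ι) → X i → Measure (Y i)} [∀ i x, IsProbabilityMeasure (κ i x)]
    (hκ : ∀ i, Measurable (κ i)) :
    ((Measure.pi μ).bind fun x => Measure.pi fun i => κ i (x i)) =
      Measure.pi fun i => (μ i).bind (κ i) := by
  have : ∀ i, IsProbabilityMeasure ((μ i).bind (κ i)) := fun i =>
    isProbabilityMeasure_bind (hκ i).aemeasurable (ae_of_all _ fun _ => inferInstance)
  refine (Measure.pi_eq fun s hs => ?_).symm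
  rw [Measure.bind_apply (.univ_pi hs)
    (measurable_measure_pi (κ := fun i (x : (i : ι) → X i) => κ i (x i))
      fun i => (hκ i).comp (measurable_pi_apply i)).aemeasurable]
  simp only [Measure.pi_pi]
  rw [lintegral_pi_prod (f := fun i x => κ i x (s i))
    fun i => (Measure.measurable_coe (hs i)).comp (hκ i)]
  exact Finset.prod_congr rfl fun i _ => (Measure.bind_apply (hs i) (hκ i).aemeasurable).symm

/-- Lets one effect be integrated out with the others fixed, without splitting the dependent
product. -/
theorem Measure.pi_prod_map_update [DecidableEq ι] (μ : (i : ι) → Measure (X i))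
    [∀ i, IsProbabilityMeasure (μ i)] (e : ι) :
    ((Measure.pi μ).prod (μ e)).map (fun p => Function.update p.1 e p.2) = Measure.pi μ := by
  have hm : Measurable fun p : ((i : ι) → X i) × X e => Function.update p.1 e p.2 := by
    refine measurable_pi_iff.2 fun i => ?_
    by_cases h : i = e
    · subst h; simpa using measurable_snd
    · simp only [Function.update_of_ne h]
      fun_prop
  refine (Measure.pi_eq fun s hs => ?_).symm
  rw [Measure.map_apply hm (.univ_pi hs)]
  -- The old coordinate `e` is overwritten, so it is unconstrained and contributes a factor one.
  have : (fun p : ((i : ι) → X i) × X e => Function.update p.1 e p.2) ⁻¹' Set.univ.pi s =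
      (Set.univ.pi (Function.update s e Set.univ)) ×ˢ s e := by
    ext ⟨x, y⟩
    simp only [Set.mem_preimage, Set.mem_univ_pi, Set.mem_prod]
    constructor
    · intro h
      refine ⟨fun i => ?_, by simpa using h e⟩
      by_cases hi : i = e
      · subst hi; simp
      · simpa [hi] using h i
    · rintro ⟨h, hy⟩ i
      by_cases hi : i = e
      · subst hi; simpa using hy
      · simpa [hi] using h i
  rw [this, Measure.prod_prod, Measure.pi_pi, ← Finset.prod_erase_mul _ _ (Finset.mem_univ e),
    ← Finset.prod_erase_mul _ _ (Finset.mem_univ e)]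
  simp only [Function.update_self, measure_univ, mul_one]
  congr 1
  refine Finset.prod_congr rfl fun i hi => ?_
  rw [Function.update_of_ne (Finset.ne_of_mem_erase hi)]

theorem integral_bind_of_bounded {μ : Measure α} [IsFiniteMeasure μ] {κ : α → Measure β}
    [∀ a, IsProbabilityMeasure (κ a)] (hκ : Measurable κ) {g : β → ℝ} (hg : Measurable g)
    {B : ℝ} (hB : ∀ z, |g z| ≤ B) :
    ∫ z, g z ∂(μ.bind κ) = ∫ a, ∫ z, g z ∂κ a ∂μ := by
  let η : Kernel α β := ⟨κ, hκ⟩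
  have : IsMarkovKernel η := ⟨fun a => inferInstanceAs (IsProbabilityMeasure (κ a))⟩
  have h : Integrable g (η ∘ₘ μ) :=
    (integrable_const B).mono' hg.aestronglyMeasurable (ae_of_all _ hB)
  rw [Measure.comp_eq_comp_const_apply] at h
  have h' := Kernel.integral_comp h
  rwa [← Measure.comp_eq_comp_const_apply, Kernel.const_apply] at h'

end Measures

/-! ### Projections of closed sets along a σ-compact factor -/

section Projection

variable {X Y : Type*} [TopologicalSpace X] [MeasurableSpace X] [BorelSpace X]
  [TopologicalSpace Y] [SigmaCompactSpace Y]

/-- Projection along a compact factor is a closed map; exhausting `Y` by compacts makes the image a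
countable union of closed sets, hence Borel. -/
theorem IsClosed.measurableSet_exists {A : Set (X × Y)} (hA : IsClosed A) :
    MeasurableSet {x | ∃ y, (x, y) ∈ A} := by
  have : {x | ∃ y, (x, y) ∈ A} = ⋃ n, {x | ∃ y ∈ compactCovering Y n, (x, y) ∈ A} := by
    ext x
    simp only [Set.mem_ofPred_eq, Set.mem_iUnion]
    constructor
    · rintro ⟨y, hy⟩
      obtain ⟨n, hn⟩ := exists_mem_compactCovering y
      exact ⟨n, y, hn, hy⟩
    · rintro ⟨n, y, -, hy⟩
      exact ⟨y, hy⟩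
  rw [this]
  refine MeasurableSet.iUnion fun n => IsClosed.measurableSet ?_
  have hc : CompactSpace (compactCovering Y n) :=
    isCompact_iff_compactSpace.1 (isCompact_compactCovering Y n)
  have h1 : IsClosed {p : X × compactCovering Y n | (p.1, (p.2 : Y)) ∈ A} :=
    hA.preimage (by fun_prop)
  convert isClosedMap_fst_of_compactSpace _ h1 using 1
  ext x
  simp

end Projection

/-! ### Consistency of weighted particle systems -/

section ParticleSystems

/-- Chebyshev: by independence the variances add, and each is at most `B ^ 2`. The laws may differ,
as moved particles start from different states. -/
theorem measure_pi_deviation_le {ι Y : Type*} [Fintype ι] [MeasurableSpace Y] {ρ : ι → Measure Y}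
    [∀ i, IsProbabilityMeasure (ρ i)] {h : Y → ℝ} (hm : Measurable h) {B : ℝ}
    (hB : ∀ i, ∀ᵐ y ∂ρ i, |h y| ≤ B) {ε : ℝ} (hε : 0 < ε) :
    Measure.pi ρ {y | ε ≤ |∑ i, h (y i) - ∑ i, ∫ x, h x ∂ρ i|} ≤
      ENNReal.ofReal (Fintype.card ι * B ^ 2 / ε ^ 2) := by
  have hL : ∀ i, MemLp h 2 (ρ i) := fun i => MemLp.of_bound hm.aestronglyMeasurable B (hB i)
  have hL' : ∀ i, MemLp (fun y : ι → Y => h (y i)) 2 (Measure.pi ρ) := fun i =>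
    (hL i).comp_measurePreserving (measurePreserving_eval ρ i)
  have hS : MemLp (∑ i, fun y : ι → Y => h (y i)) 2 (Measure.pi ρ) :=
    memLp_finsetSum' _ fun i _ => hL' i
  have hE : ∫ y, (∑ i, fun y : ι → Y => h (y i)) y ∂Measure.pi ρ = ∑ i, ∫ x, h x ∂ρ i := by
    simp only [Finset.sum_apply]
    rw [integral_finsetSum _ fun i _ => (hL' i).integrable (by norm_num)]
    refine Finset.sum_congr rfl fun i _ => ?_
    conv_rhs => rw [← (measurePreserving_eval ρ i).map_eq]
    rw [integral_map (measurable_pi_apply i).aemeasurable hm.aestronglyMeasurable]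
  have hV : Var[∑ i, fun y : ι → Y => h (y i); Measure.pi ρ] ≤ Fintype.card ι * B ^ 2 := by
    rw [variance_sum_pi hL]
    calc ∑ i, Var[h; ρ i] ≤ ∑ _i : ι, B ^ 2 := by
          refine Finset.sum_le_sum fun i _ => ?_
          have := variance_le_sq_of_bounded (μ := ρ i) (X := h) (a := -B) (b := B)
            ((hB i).mono fun y hy => abs_le.1 hy) hm.aemeasurable
          simpa using this
      _ = _ := by simp
  have := meas_ge_le_variance_div_sq hS hε
  rw [hE] at this
  simp only [Finset.sum_apply] at this
  exact this.trans (ENNReal.ofReal_le_ofReal (by gcongr))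

theorem sum_weights_div_eq_one {Z : Type*} {N : ℕ} {s : Fin N → Z × ℝ≥0} (hs : ∑ J, (s J).2 ≠ 0) :
    ∑ J, (s J).2 / ∑ I, (s I).2 = 1 := by
  rw [← Finset.sum_div, div_self hs]

/-- Splits according to whether the current system is bad: on `D` the kernel mass is at most one,
off `D` at most `r`. The set `D` need not be measurable. -/
theorem measure_bind_le_add {α β : Type*} [MeasurableSpace α] [MeasurableSpace β] {μ : Measure α}
    [IsProbabilityMeasure μ] {κ : α → Measure β} [∀ a, IsProbabilityMeasure (κ a)]
    (hκ : Measurable κ) {A : Set β} (hA : MeasurableSet A) {D : Set α} {r : ℝ≥0∞}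
    (h : ∀ᵐ a ∂μ, a ∉ D → κ a A ≤ r) : (μ.bind κ) A ≤ μ D + r := by
  rw [Measure.bind_apply hA hκ.aemeasurable]
  calc ∫⁻ a, κ a A ∂μ ≤ ∫⁻ a, (D.indicator 1 a + r) ∂μ := by
        refine lintegral_mono_ae (h.mono fun a ha => ?_)
        by_cases hD : a ∈ D
        · simp only [Set.indicator_of_mem hD, Pi.one_apply]
          exact prob_le_one.trans le_self_add
        · simpa [hD] using ha hD
    _ = ∫⁻ a, D.indicator 1 a ∂μ + r := by
        rw [lintegral_add_right _ measurable_const]; simp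
    _ ≤ μ D + r := by gcongr; exact lintegral_indicator_one_le D

variable {Z : Type*} [MeasurableSpace Z]

/-- A sequence of random weighted particle systems with bounded weights whose weighted averages
converge in probability to those of the normalized measure `γ`. -/
structure IsConsistent (γ : Measure Z) (L : (N : ℕ) → Measure (Fin N → Z × ℝ≥0)) : Prop where
  prob : ∀ N, IsProbabilityMeasure (L N)
  bounded : ∃ B : ℝ≥0, ∀ N, ∀ᵐ s ∂L N, ∀ J, (s J).2 ≤ B
  -- Only a lower bound: the total weight depends on whether resampling took place, so no limit of
  -- the total weight over `N` is claimed.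
  mass : ∃ δ : ℝ, 0 < δ ∧
    Tendsto (fun N => L N {s | ∑ J, ((s J).2 : ℝ) < δ * N}) atTop (𝓝 0)
  -- For centred `g` the limit is zero whatever the scale of the weights or the total mass of `γ`.
  conv : ∀ g : Z → ℝ, Measurable g → (∃ B, ∀ z, |g z| ≤ B) → ∫ z, g z ∂γ = 0 → ∀ ε : ℝ, 0 < ε →
    Tendsto (fun N : ℕ => L N {s | ε * N ≤ |∑ J, g (s J).1 * ((s J).2 : ℝ)|}) atTop (𝓝 0)

/-- Independent moves of the particles, with an update of the weights. -/
noncomputable def moveStep (K : Z → Measure Z) (w : Z → ℝ≥0) {N : ℕ} (s : Fin N → Z × ℝ≥0) :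
    Measure (Fin N → Z × ℝ≥0) :=
  Measure.pi fun J => (K (s J).1).map fun z => (z, (s J).2 * w z)

variable {K : Z → Measure Z} {w : Z → ℝ≥0}

theorem integral_map_weight (hw : Measurable w) {g : Z → ℝ} (hg : Measurable g) (y : Z × ℝ≥0) :
    ∫ x, g x.1 * (x.2 : ℝ) ∂(K y.1).map (fun z => (z, y.2 * w z)) =
      (∫ z, g z * w z ∂K y.1) * y.2 := by
  rw [integral_map (by fun_prop) (Measurable.aestronglyMeasurable (by fun_prop)),
    ← integral_mul_const]
  congr with z
  push_cast
  ring

theorem measurable_integral_mul_weight (hK : Measurable K) (hw : Measurable w) {g : Z → ℝ}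
    (hg : Measurable g) : Measurable fun z => ∫ z', g z' * w z' ∂K z := by
  let η : Kernel Z Z := ⟨K, hK⟩
  have h : StronglyMeasurable fun z' => g z' * (w z' : ℝ) :=
    Measurable.stronglyMeasurable (by fun_prop)
  exact (h.integral_kernel (κ := η)).measurable

/-- The law of one particle after resampling and a move. -/
noncomputable def resampleMoveLaw (K : Z → Measure Z) {N : ℕ} (s : Fin N → Z × ℝ≥0) :
    Measure (Z × ℝ≥0) :=
  ∑ J, ((s J).2 / ∑ I, (s I).2 : ℝ≥0) • (K (s J).1).map fun z => (z, (1 : ℝ≥0))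

theorem ae_resampleMoveLaw {N : ℕ} {s : Fin N → Z × ℝ≥0} {p : Z × ℝ≥0 → Prop}
    (hp : MeasurableSet {y | p y}) (h : ∀ z, p (z, 1)) : ∀ᵐ y ∂resampleMoveLaw K s, p y := by
  have hc : MeasurableSet {y | ¬p y} := hp.compl
  rw [ae_iff]
  simp only [resampleMoveLaw, Measure.coe_finsetSum, Finset.sum_apply, Measure.smul_apply]
  refine Finset.sum_eq_zero fun J _ => ?_
  rw [Measure.map_apply (by fun_prop) hc]
  simp [h]

variable [∀ z, IsProbabilityMeasure (K z)]

theorem isProbabilityMeasure_map_weight (hw : Measurable w) (y : Z × ℝ≥0) :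
    IsProbabilityMeasure ((K y.1).map fun z => (z, y.2 * w z)) :=
  Measure.isProbabilityMeasure_map (by fun_prop)

theorem isProbabilityMeasure_moveStep (hw : Measurable w) {N : ℕ} (s : Fin N → Z × ℝ≥0) :
    IsProbabilityMeasure (moveStep K w s) := by
  have := fun J => isProbabilityMeasure_map_weight (K := K) hw (s J)
  unfold moveStep
  infer_instance

theorem measurable_map_weight (hK : Measurable K) (hw : Measurable w) :
    Measurable fun y : Z × ℝ≥0 => (K y.1).map fun z => (z, y.2 * w z) :=
  measurable_measure_map_uncurry (κ := fun y : Z × ℝ≥0 => K y.1) (hK.comp measurable_fst) (by unfold Function.uncurry; fun_prop)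

theorem measurable_moveStep (hK : Measurable K) (hw : Measurable w) {N : ℕ} :
    Measurable (moveStep K w (N := N)) := by
  have := fun (_ : Fin N) (s : Fin N → Z × ℝ≥0) J =>
    isProbabilityMeasure_map_weight (K := K) hw (s J)
  exact measurable_measure_pi
    (κ := fun J (s : Fin N → Z × ℝ≥0) => (K (s J).1).map fun z => (z, (s J).2 * w z))
    fun J => (measurable_map_weight hK hw).comp (measurable_pi_apply J)

/-- The subtracted sum is the conditional mean given the current system, so this is Chebyshev with
summands bounded by `G * (B * b)`. -/
theorem moveStep_deviation_le (hw : Measurable w) {b : ℝ≥0} (hb : ∀ z, w z ≤ b)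
    {g : Z → ℝ} (hg : Measurable g) {G : ℝ} (hG : ∀ z, |g z| ≤ G) {N : ℕ} {s : Fin N → Z × ℝ≥0}
    {B : ℝ≥0} (hs : ∀ J, (s J).2 ≤ B) {ε : ℝ} (hε : 0 < ε) :
    moveStep K w s {s' | ε ≤ |∑ J, g (s' J).1 * ((s' J).2 : ℝ) -
      ∑ J, (∫ z, g z * w z ∂K (s J).1) * (s J).2|} ≤
      ENNReal.ofReal (N * (G * (B * b)) ^ 2 / ε ^ 2) := by
  have := fun J => isProbabilityMeasure_map_weight (K := K) hw (s J)
  have h := measure_pi_deviation_le (ρ := fun J => (K (s J).1).map fun z => (z, (s J).2 * w z))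
    (h := fun x => g x.1 * (x.2 : ℝ)) (by fun_prop) (B := G * (B * b)) (fun J => ?_) hε
  · simp only [integral_map_weight hw hg, Fintype.card_fin] at h
    exact h
  · rw [ae_map_iff (by fun_prop) (measurableSet_le (by fun_prop) (by fun_prop))]
    refine ae_of_all _ fun z => ?_
    have h1 : (((s J).2 * w z : ℝ≥0) : ℝ) ≤ B * b := by exact_mod_cast mul_le_mul' (hs J) (hb z)
    rw [abs_mul, NNReal.abs_eq]
    exact mul_le_mul (hG z) h1 (NNReal.coe_nonneg _) ((abs_nonneg _).trans (hG z))

theorem tendsto_ofReal_mul_div_sq (C : ℝ) {ε : ℝ} (hε : 0 < ε) :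
    Tendsto (fun N : ℕ => ENNReal.ofReal (N * C / (ε * N) ^ 2)) atTop (𝓝 0) := by
  have h : Tendsto (fun N : ℕ => C / ε ^ 2 / (N : ℝ)) atTop (𝓝 0) :=
    tendsto_const_div_atTop_nhds_zero_nat _
  rw [← ENNReal.ofReal_zero]
  refine (ENNReal.continuous_ofReal.tendsto 0).comp (h.congr' ?_)
  filter_upwards [eventually_gt_atTop 0] with N hN
  have : (N : ℝ) ≠ 0 := by positivity
  field_simp

theorem abs_integral_mul_weight_le {b : ℝ≥0} (hb : ∀ z, w z ≤ b) {g : Z → ℝ} {G : ℝ}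
    (hG : ∀ z, |g z| ≤ G) (z : Z) : |∫ z', g z' * w z' ∂K z| ≤ G * b := by
  have h := norm_integral_le_of_norm_le_const (μ := K z) (f := fun z' => g z' * (w z' : ℝ))
    (C := G * b) (ae_of_all _ fun z' => ?_)
  · simpa using h
  · rw [Real.norm_eq_abs, abs_mul, NNReal.abs_eq]
    exact mul_le_mul (hG z') (by exact_mod_cast hb z') (NNReal.coe_nonneg _)
      ((abs_nonneg _).trans (hG z'))


theorem measurableSet_le_abs_weighted_sum {g : Z → ℝ} (hg : Measurable g) {N : ℕ} (x : ℝ) :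
    MeasurableSet {s : Fin N → Z × ℝ≥0 | x ≤ |∑ J, g (s J).1 * ((s J).2 : ℝ)|} := by
  have : Measurable fun s : Fin N → Z × ℝ≥0 => ∑ J, g (s J).1 * ((s J).2 : ℝ) := by fun_prop
  exact measurableSet_le measurable_const (continuous_abs.measurable.comp this)

theorem measurableSet_total_weight_lt {N : ℕ} (x : ℝ) :
    MeasurableSet {s : Fin N → Z × ℝ≥0 | ∑ J, ((s J).2 : ℝ) < x} :=
  measurableSet_lt (by fun_prop) measurable_const

theorem ae_forall_moveStep (hw : Measurable w) {N : ℕ} {s : Fin N → Z × ℝ≥0} {p : Z × ℝ≥0 → Prop}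
    (hp : MeasurableSet {y | p y}) (h : ∀ J z, p (z, (s J).2 * w z)) :
    ∀ᵐ s' ∂moveStep K w s, ∀ J, p (s' J) := by
  have := fun J => isProbabilityMeasure_map_weight (K := K) hw (s J)
  refine ae_all_iff.2 fun J => ?_
  refine (measurePreserving_eval _ J).quasiMeasurePreserving.ae ?_
  rw [ae_map_iff (by fun_prop) hp]
  exact ae_of_all _ (h J)

theorem ae_bind_of_forall {α β : Type*} [MeasurableSpace α] [MeasurableSpace β] {μ : Measure α}
    {κ : α → Measure β} (hκ : Measurable κ) {p : β → Prop} (hp : MeasurableSet {y | p y})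
    (h : ∀ᵐ a ∂μ, ∀ᵐ y ∂κ a, p y) : ∀ᵐ y ∂μ.bind κ, p y := by
  have hc : MeasurableSet {y | ¬p y} := hp.compl
  have hm : Measurable fun a => κ a {y | ¬p y} := (Measure.measurable_coe hc).comp hκ
  rw [ae_iff, Measure.bind_apply hc hκ.aemeasurable, lintegral_eq_zero_iff hm]
  exact h.mono fun a ha => ha

/-- The hypothesis `h` makes `z ↦ ∫ g w dK z` centred for `γ` when `g` is centred for `γ'`. The old
system thus controls the conditional mean of the new sum, and Chebyshev the deviation from it. The
constant `c` plays no role beyond its positivity. -/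
theorem IsConsistent.move {γ γ' : Measure Z} [IsFiniteMeasure γ] [IsFiniteMeasure γ']
    {L : (N : ℕ) → Measure (Fin N → Z × ℝ≥0)} (hL : IsConsistent γ L) (hK : Measurable K)
    (hw : Measurable w) {b : ℝ≥0} (hb : ∀ z, w z ≤ b) {c : ℝ} (hc : 0 < c) (hγ' : γ' ≠ 0)
    (h : ∀ g : Z → ℝ, Measurable g → (∃ B, ∀ z, |g z| ≤ B) →
      ∫ z, ∫ z', g z' * w z' ∂K z ∂γ = c * ∫ z, g z ∂γ') :
    IsConsistent γ' fun N => (L N).bind (moveStep K w) := by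
  obtain ⟨B, hB⟩ := hL.bounded
  obtain ⟨δ, hδ, hmass⟩ := hL.mass
  have hprob := hL.prob
  have hP : ∀ N (s : Fin N → Z × ℝ≥0), IsProbabilityMeasure (moveStep K w s) := fun N s =>
    isProbabilityMeasure_moveStep hw s
  have hM : ∀ N, Measurable (moveStep K w (N := N)) := fun N => measurable_moveStep hK hw
  refine ⟨fun N => isProbabilityMeasure_bind (hM N).aemeasurable (ae_of_all _ (hP N)),
    ⟨B * b, fun N => ?_⟩, ?_, ?_⟩
  · refine ae_bind_of_forall (hM N) ?_ ?_
    · simp only [Set.ofPred_forall]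
      exact MeasurableSet.iInter fun J => measurableSet_le (by fun_prop) measurable_const
    · filter_upwards [hB N] with s hs
      exact ae_forall_moveStep hw (p := fun y => y.2 ≤ B * b)
        (measurableSet_le (by fun_prop) measurable_const) fun J z => mul_le_mul' (hs J) (hb z)
  · set m := γ'.real Set.univ with hm
    have hm0 : 0 < m := by
      rw [hm, measureReal_def, ENNReal.toReal_pos_iff]
      exact ⟨by simpa [pos_iff_ne_zero] using hγ', measure_lt_top _ _⟩
    have h1 := h (fun _ => 1) measurable_const ⟨1, by simp⟩
    simp only [integral_const, smul_eq_mul, mul_one] at h1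
    set m₀ := γ.real Set.univ with hm₀
    -- Nonvanishing of `γ` is not assumed: the identity for `g = 1` would read `0 = c * m`
    -- otherwise.
    have hm₀0 : 0 < m₀ := by
      rw [hm₀, measureReal_def, ENNReal.toReal_pos_iff]
      refine ⟨pos_iff_ne_zero.2 fun h0 => ?_, measure_lt_top _ _⟩
      rw [Measure.measure_univ_eq_zero] at h0
      rw [h0, integral_zero_measure] at h1
      exact (mul_pos hc hm0).ne h1
    -- The mean of `φ = ∫ w dK` under the normalized `γ`, so that `φ - a` is centred. Hence the
    -- conditional mean of the new total weight is close to `a` times the old total, which is at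
    -- least `a * δ * N`; two errors of `a * δ / 4 * N` leave half of this.
    set a := c * m / m₀
    have ha : 0 < a := by positivity
    have hmeas := measurable_integral_mul_weight hK hw (g := fun _ => 1) measurable_const
    have hbd := fun z => abs_integral_mul_weight_le (K := K) hb (g := fun _ => 1) (G := 1)
      (by simp) z
    refine ⟨a * δ / 2, by positivity, ?_⟩
    set φ : Z → ℝ := fun z => ∫ z', 1 * (w z' : ℝ) ∂K z with hφ
    have hφi : Integrable φ γ := (integrable_const (1 * (b : ℝ))).mono' hmeas.aestronglyMeasurable
      (ae_of_all _ hbd)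
    have hconv := hL.conv (fun z => φ z - a) (hmeas.sub_const a)
      ⟨1 * b + |a|, fun z => (abs_sub _ _).trans (by gcongr; exact hbd z)⟩ (by
        rw [integral_sub hφi (integrable_const a), h1, integral_const, smul_eq_mul, ← hm, ← hm₀]
        simp only [a]
        field_simp
        ring) (a * δ / 4) (by positivity)
    have hlim := (hmass.add hconv).add
      (tendsto_ofReal_mul_div_sq ((1 * ((B : ℝ) * b)) ^ 2) (ε := a * δ / 4) (by positivity))
    simp only [add_zero] at hlim
    refine tendsto_of_tendsto_of_tendsto_of_le_of_le' tendsto_const_nhds hlim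
      (Eventually.of_forall fun _ => zero_le) ?_
    filter_upwards [eventually_gt_atTop 0] with N hN
    have hN' : (0 : ℝ) < N := by exact_mod_cast hN
    refine (measure_bind_le_add (hM N) (measurableSet_total_weight_lt _) (D :=
      {s | ∑ J, ((s J).2 : ℝ) < δ * N} ∪
      {s | a * δ / 4 * N ≤ |∑ J, (φ (s J).1 - a) * ((s J).2 : ℝ)|}) ?_).trans
      (add_le_add (measure_union_le _ _) le_rfl)
    filter_upwards [hB N] with s hs hD
    simp only [Set.mem_union, Set.mem_ofPred_eq, not_or, not_lt, not_le] at hD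
    obtain ⟨hD1, hD2⟩ := hD
    refine (measure_mono ?_).trans (moveStep_deviation_le (K := K) hw hb (g := fun _ => 1)
      measurable_const (G := 1) (by simp) hs (ε := a * δ / 4 * N) (by positivity))
    intro s' hs'
    simp only [Set.mem_ofPred_eq, one_mul] at hs' ⊢
    simp only [hφ, one_mul, sub_mul, Finset.sum_sub_distrib, ← Finset.mul_sum] at hD2
    have h2 := abs_lt.1 hD2
    have h3 : a * (δ * N) ≤ a * ∑ J, ((s J).2 : ℝ) := by gcongr
    rw [abs_sub_comm]
    refine le_trans ?_ (le_abs_self _)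
    nlinarith [h2.1]
  · rintro g hg ⟨G, hG⟩ hg0 ε hε
    have hmeas := measurable_integral_mul_weight hK hw hg
    have hconv := hL.conv (fun z => ∫ z', g z' * w z' ∂K z) hmeas
      ⟨_, abs_integral_mul_weight_le hb hG⟩ (by rw [h g hg ⟨G, hG⟩, hg0, mul_zero]) (ε / 2)
      (by positivity)
    have hlim := hconv.add
      (tendsto_ofReal_mul_div_sq ((G * ((B : ℝ) * b)) ^ 2) (ε := ε / 2) (by positivity))
    simp only [add_zero] at hlim
    refine tendsto_of_tendsto_of_tendsto_of_le_of_le' tendsto_const_nhds hlim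
      (Eventually.of_forall fun _ => zero_le) ?_
    filter_upwards [eventually_gt_atTop 0] with N hN
    have hN' : (0 : ℝ) < N := by exact_mod_cast hN
    refine measure_bind_le_add (hM N) (measurableSet_le_abs_weighted_sum hg _) ?_
    filter_upwards [hB N] with s hs hD
    simp only [not_le] at hD
    refine (measure_mono ?_).trans (moveStep_deviation_le (K := K) hw hb hg hG hs
      (ε := ε / 2 * N) (by positivity))
    intro s' hs'
    simp only [Set.mem_ofPred_eq] at hs' ⊢
    have := abs_sub_abs_le_abs_sub (∑ J, g (s' J).1 * ((s' J).2 : ℝ))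
      (∑ J, (∫ z', g z' * w z' ∂K (s J).1) * ((s J).2 : ℝ))
    linarith

/-- Multinomial resampling. -/
noncomputable def resample {N : ℕ} (s : Fin N → Z × ℝ≥0) : Measure (Fin N → Z × ℝ≥0) :=
  Measure.pi fun _ => ∑ J, (((s J).2 / ∑ I, (s I).2 : ℝ≥0) : ℝ≥0∞) • Measure.dirac ((s J).1, 1)

theorem measurable_resample {N : ℕ} : Measurable (resample (Z := Z) (N := N)) := by
  let ρ : Fin N → (Fin N → Z × ℝ≥0) → Measure (Z × ℝ≥0) := fun _ s =>
    ∑ J, (((s J).2 / ∑ I, (s I).2 : ℝ≥0) : ℝ≥0∞) • Measure.dirac ((s J).1, 1)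
  -- If all weights vanish, the quotients are zero and so is the measure; only finiteness holds for
  -- every `s`.
  have : ∀ i s, IsFiniteMeasure (ρ i s) := fun i s =>
    ⟨by simp [ρ, Measure.coe_finsetSum, ENNReal.sum_lt_top]⟩
  refine measurable_measure_pi (κ := ρ) (hfin := this) fun _ => ?_
  refine Measure.measurable_of_measurable_coe _ fun A hA => ?_
  simp only [ρ, Measure.coe_finsetSum, Finset.sum_apply, Measure.smul_apply, smul_eq_mul]
  refine Finset.measurable_sum _ fun J _ => Measurable.mul (by fun_prop) ?_
  have h1 : Measurable fun s : Fin N → Z × ℝ≥0 => ((s J).1, (1 : ℝ≥0)) := by fun_prop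
  exact (Measure.measurable_coe hA).comp (Measure.measurable_dirac.comp h1)

theorem isProbabilityMeasure_resampleMoveLaw {N : ℕ} {s : Fin N → Z × ℝ≥0}
    (hs : ∑ J, (s J).2 ≠ 0) : IsProbabilityMeasure (resampleMoveLaw K s) := by
  constructor
  have : ∀ J, IsProbabilityMeasure ((K (s J).1).map fun z => (z, (1 : ℝ≥0))) := fun J =>
    Measure.isProbabilityMeasure_map (by fun_prop)
  simp only [resampleMoveLaw, Measure.coe_finsetSum, Finset.sum_apply, Measure.smul_apply,
    measure_univ, ENNReal.smul_def, smul_eq_mul, mul_one]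
  exact_mod_cast sum_weights_div_eq_one hs

/-- Selecting and then moving is done independently in each slot, so given `s` the new particles are
i.i.d. from one mixture. Treating the two operations together needs a single Chebyshev bound. -/
theorem resample_bind_moveStep (hK : Measurable K) {N : ℕ} {s : Fin N → Z × ℝ≥0}
    (hs : ∑ J, (s J).2 ≠ 0) :
    (resample s).bind (moveStep K fun _ => 1) = Measure.pi fun _ => resampleMoveLaw K s := by
  have h1 : IsProbabilityMeasure (∑ J, (((s J).2 / ∑ I, (s I).2 : ℝ≥0) : ℝ≥0∞) •
      Measure.dirac ((s J).1, (1 : ℝ≥0))) := by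
    constructor
    simp only [Measure.coe_finsetSum, Finset.sum_apply, Measure.smul_apply,
      measure_univ, smul_eq_mul, mul_one]
    exact_mod_cast sum_weights_div_eq_one hs
  have h2 := isProbabilityMeasure_map_weight (K := K) (w := fun _ => 1) measurable_const
  have hm := measurable_map_weight hK (w := fun _ => 1) measurable_const
  have h3 := Measure.pi_bind_pi (ι := Fin N) (μ := fun _ =>
      ∑ J, (((s J).2 / ∑ I, (s I).2 : ℝ≥0) : ℝ≥0∞) • Measure.dirac ((s J).1, (1 : ℝ≥0)))
    (κ := fun _ (y : Z × ℝ≥0) => (K y.1).map fun z => (z, y.2 * 1)) fun _ => hm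
  refine h3.trans ?_
  congr with _ A hA
  have hmA : Measurable fun y : Z × ℝ≥0 => (K y.1).map (fun z => (z, y.2 * 1)) A :=
    (Measure.measurable_coe hA).comp hm
  rw [Measure.bind_apply hA hm.aemeasurable]
  simp only [resampleMoveLaw, lintegral_finsetSum_measure, lintegral_smul_measure, smul_eq_mul]
  simp only [Measure.coe_finsetSum, Finset.sum_apply, Measure.smul_apply, ENNReal.smul_def,
    smul_eq_mul]
  refine Finset.sum_congr rfl fun J _ => ?_
  rw [lintegral_dirac' _ hmA]
  simp

theorem integral_resampleMoveLaw {g : Z → ℝ} (hg : Measurable g) {G : ℝ} (hG : ∀ z, |g z| ≤ G)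
    {N : ℕ} {s : Fin N → Z × ℝ≥0} :
    ∫ y, g y.1 * (y.2 : ℝ) ∂resampleMoveLaw K s =
      (∑ J, (∫ z, g z ∂K (s J).1) * (s J).2) / ∑ J, ((s J).2 : ℝ) := by
  have hm : Measurable fun z : Z => (z, (1 : ℝ≥0)) := by fun_prop
  have hm' : Measurable fun y : Z × ℝ≥0 => g y.1 * (y.2 : ℝ) := by fun_prop
  have hi : ∀ J, Integrable (fun y : Z × ℝ≥0 => g y.1 * (y.2 : ℝ))
      ((K (s J).1).map fun z => (z, (1 : ℝ≥0))) := fun J => by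
    rw [integrable_map_measure hm'.aestronglyMeasurable hm.aemeasurable]
    refine (integrable_const G).mono' (hm'.comp hm).aestronglyMeasurable (ae_of_all _ fun z => ?_)
    simpa using hG z
  rw [resampleMoveLaw, integral_finsetSum_measure fun J _ => (hi J).smul_measure_nnreal,
    Finset.sum_div]
  refine Finset.sum_congr rfl fun J _ => ?_
  rw [integral_smul_nnreal_measure, integral_map hm.aemeasurable hm'.aestronglyMeasurable]
  simp only [NNReal.coe_one, mul_one, NNReal.smul_def, smul_eq_mul]
  push_cast
  ring

theorem resampleMove_deviation_le {g : Z → ℝ} (hg : Measurable g) {G : ℝ} (hG : ∀ z, |g z| ≤ G)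
    {N : ℕ} {s : Fin N → Z × ℝ≥0} (hs : ∑ J, (s J).2 ≠ 0) {ε : ℝ} (hε : 0 < ε) :
    (Measure.pi fun _ : Fin N => resampleMoveLaw K s) {s' | ε ≤ |∑ J, g (s' J).1 * ((s' J).2 : ℝ) -
      N * ((∑ J, (∫ z, g z ∂K (s J).1) * (s J).2) / ∑ J, ((s J).2 : ℝ))|} ≤
      ENNReal.ofReal (N * G ^ 2 / ε ^ 2) := by
  have := isProbabilityMeasure_resampleMoveLaw (K := K) hs
  have h := measure_pi_deviation_le (ρ := fun _ : Fin N => resampleMoveLaw K s)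
    (h := fun x => g x.1 * (x.2 : ℝ)) (by fun_prop) (B := G) (fun J => ?_) hε
  · simpa only [integral_resampleMoveLaw hg hG, Fintype.card_fin, Finset.sum_const,
      Finset.card_univ, nsmul_eq_mul] using h
  · refine ae_resampleMoveLaw (measurableSet_le (by fun_prop) (by fun_prop)) fun z => ?_
    simpa using hG z

/-- Resampling followed by a move, performed on the event `P`. -/
noncomputable def resampleMoveStep (K : Z → Measure Z) {N : ℕ} (P : (Fin N → Z × ℝ≥0) → Prop)
    (s : Fin N → Z × ℝ≥0) : Measure (Fin N → Z × ℝ≥0) :=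
  if P s then (resample s).bind (moveStep K fun _ => 1) else Measure.dirac s

theorem measurable_resampleMoveStep (hK : Measurable K) {N : ℕ} {P : (Fin N → Z × ℝ≥0) → Prop}
    (hP : MeasurableSet {s | P s}) : Measurable (resampleMoveStep K P) :=
  Measurable.ite hP ((Measure.measurable_bind' (measurable_moveStep hK measurable_const)).comp
    measurable_resample) Measure.measurable_dirac

theorem isProbabilityMeasure_resampleMoveStep (hK : Measurable K) {N : ℕ}
    {P : (Fin N → Z × ℝ≥0) → Prop} (hP : ∀ s, P s → ∑ J, (s J).2 ≠ 0) (s : Fin N → Z × ℝ≥0) :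
    IsProbabilityMeasure (resampleMoveStep K P s) := by
  unfold resampleMoveStep
  split_ifs with h
  · have := isProbabilityMeasure_resampleMoveLaw (K := K) (hP s h)
    rw [resample_bind_moveStep hK (hP s h)]
    infer_instance
  · infer_instance

/-- The event `P N` is arbitrary apart from measurability and nonzero total weight: off a bad set of
vanishing probability, the estimates hold on both branches, so nothing about the frequency of
resampling is needed. -/
theorem IsConsistent.resampleMove {γ : Measure Z} [IsFiniteMeasure γ]
    {L : (N : ℕ) → Measure (Fin N → Z × ℝ≥0)} (hL : IsConsistent γ L) (hK : Measurable K)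
    (hγ : γ.bind K = γ) {P : (N : ℕ) → (Fin N → Z × ℝ≥0) → Prop}
    (hPm : ∀ N, MeasurableSet {s | P N s}) (hP : ∀ N s, P N s → ∑ J, (s J).2 ≠ 0) :
    IsConsistent γ fun N => (L N).bind (resampleMoveStep K (P N)) := by
  obtain ⟨B, hB⟩ := hL.bounded
  obtain ⟨δ, hδ, hmass⟩ := hL.mass
  have hprob := hL.prob
  have hPr : ∀ N s, IsProbabilityMeasure (resampleMoveStep K (P N) s) := fun N s =>
    isProbabilityMeasure_resampleMoveStep hK (hP N) s
  have hM : ∀ N, Measurable (resampleMoveStep K (P N)) := fun N =>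
    measurable_resampleMoveStep hK (hPm N)
  have hone : ∀ N s, P N s → ∀ᵐ s' ∂resampleMoveStep K (P N) s, ∀ J, (s' J).2 = 1 := by
    intro N s hs
    have := isProbabilityMeasure_resampleMoveLaw (K := K) (hP N s hs)
    rw [resampleMoveStep, if_pos hs, resample_bind_moveStep hK (hP N s hs)]
    refine ae_all_iff.2 fun J => ?_
    refine (measurePreserving_eval (fun _ : Fin N => resampleMoveLaw K s)
      J).quasiMeasurePreserving.ae (p := fun y => y.2 = 1) ?_
    exact ae_resampleMoveLaw (p := fun y => y.2 = 1)
      (measurable_snd (measurableSet_singleton _)) fun z => rfl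
  refine ⟨fun N => isProbabilityMeasure_bind (hM N).aemeasurable (ae_of_all _ (hPr N)),
    ⟨max B 1, fun N => ?_⟩, ?_, ?_⟩
  · have hm : MeasurableSet {s : Fin N → Z × ℝ≥0 | ∀ J, (s J).2 ≤ max B 1} := by
      simp only [Set.ofPred_forall]
      exact MeasurableSet.iInter fun J => measurableSet_le (by fun_prop) measurable_const
    refine ae_bind_of_forall (hM N) hm ?_
    filter_upwards [hB N] with s hs
    by_cases h : P N s
    · filter_upwards [hone N s h] with s' hs' J
      simp [hs' J]
    · rw [resampleMoveStep, if_neg h, ae_dirac_iff hm]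
      exact fun J => (hs J).trans (le_max_left _ _)
  · refine ⟨min δ 1, by positivity, ?_⟩
    refine tendsto_of_tendsto_of_tendsto_of_le_of_le tendsto_const_nhds hmass
      (fun _ => zero_le) fun N => ?_
    refine (measure_bind_le_add (hM N) (measurableSet_total_weight_lt _) (r := 0) (D :=
      {s | ∑ J, ((s J).2 : ℝ) < δ * N}) (ae_of_all _ fun s hs => ?_)).trans (by simp)
    simp only [Set.mem_ofPred_eq, not_lt] at hs
    rw [nonpos_iff_eq_zero]
    by_cases h : P N s
    · rw [← compl_compl {s : Fin N → Z × ℝ≥0 | _}, ← mem_ae_iff]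
      filter_upwards [hone N s h] with s' hs'
      simp only [Set.mem_compl_iff, Set.mem_ofPred_eq, hs', not_lt]
      simp only [NNReal.coe_one, Finset.sum_const, Finset.card_univ, Fintype.card_fin,
        nsmul_eq_mul, mul_one]
      exact mul_le_of_le_one_left (by positivity) (min_le_right _ _)
    · rw [resampleMoveStep, if_neg h, Measure.dirac_apply' _ (measurableSet_total_weight_lt _)]
      refine Set.indicator_of_notMem ?_ _
      simp only [Set.mem_ofPred_eq, not_lt]
      refine le_trans ?_ hs
      gcongr
      exact min_le_left _ _
  · rintro g hg ⟨G, hG⟩ hg0 ε hε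
    have hmeas := measurable_integral_mul_weight hK (w := fun _ => 1) measurable_const hg
    have hbd := abs_integral_mul_weight_le (K := K) (w := fun _ => 1) (b := 1)
      (fun _ => le_rfl) hG
    simp only [NNReal.coe_one, mul_one] at hmeas hbd
    have hconv := hL.conv (fun z => ∫ z', g z' ∂K z) hmeas
      ⟨_, hbd⟩ (by rw [← integral_bind_of_bounded hK hg hG, hγ, hg0]) (ε * δ / 2)
      (by positivity)
    have hlim := (((hL.conv g hg ⟨G, hG⟩ hg0 ε hε).add hmass).add hconv).add
      (tendsto_ofReal_mul_div_sq (G ^ 2) (ε := ε / 2) (by positivity))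
    simp only [add_zero] at hlim
    refine tendsto_of_tendsto_of_tendsto_of_le_of_le' tendsto_const_nhds hlim
      (Eventually.of_forall fun _ => zero_le) ?_
    filter_upwards [eventually_gt_atTop 0] with N hN
    have hN' : (0 : ℝ) < N := by exact_mod_cast hN
    -- The first set settles the branch without resampling. The other two bound the conditional mean
    -- `N * (m / W)` after resampling: `W ≥ δ N` and `|m| < ε δ / 2 * N` give at most `ε / 2 * N`.
    refine (measure_bind_le_add (hM N) (measurableSet_le_abs_weighted_sum hg _) (D :=
      ({s | ε * N ≤ |∑ J, g (s J).1 * ((s J).2 : ℝ)|} ∪ {s | ∑ J, ((s J).2 : ℝ) < δ * N}) ∪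
      {s | ε * δ / 2 * N ≤ |∑ J, (∫ z', g z' ∂K (s J).1) * ((s J).2 : ℝ)|})
      (ae_of_all _ fun s hD => ?_)).trans
      (add_le_add ((measure_union_le _ _).trans
        (add_le_add (measure_union_le _ _) le_rfl)) le_rfl)
    simp only [Set.mem_union, not_or] at hD
    obtain ⟨⟨hD1, hD2⟩, hD3⟩ := hD
    by_cases h : P N s
    · rw [resampleMoveStep, if_pos h, resample_bind_moveStep hK (hP N s h)]
      refine (measure_mono ?_).trans (resampleMove_deviation_le (K := K) hg hG (hP N s h)
        (ε := ε / 2 * N) (by positivity))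
      intro s' hs'
      simp only [Set.mem_ofPred_eq, not_lt, not_le] at hs' hD2 hD3 ⊢
      set m := ∑ J, (∫ z', g z' ∂K (s J).1) * ((s J).2 : ℝ)
      set W := ∑ J, ((s J).2 : ℝ)
      have hW : 0 < W := lt_of_lt_of_le (by positivity) hD2
      have h1 : |N * (m / W)| ≤ ε / 2 * N := by
        rw [abs_mul, abs_div, abs_of_pos hW, abs_of_pos hN', mul_comm]
        refine mul_le_mul_of_nonneg_right ?_ hN'.le
        rw [div_le_iff₀ hW]
        nlinarith
      have := abs_sub_abs_le_abs_sub (∑ J, g (s' J).1 * ((s' J).2 : ℝ)) (N * (m / W))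
      linarith
    · rw [resampleMoveStep, if_neg h, Measure.dirac_apply' _ (measurableSet_le_abs_weighted_sum hg _),
        Set.indicator_of_notMem hD1]
      exact zero_le

/-- With `a` the normalized mean of `f`, the error equals the weighted sum of the centred function
`f - a` divided by the total weight: less than `ε δ N` over at least `δ N`. -/
theorem IsConsistent.tendsto_weighted_average {γ : Measure Z} [IsFiniteMeasure γ] (hγ : γ ≠ 0)
    {L : (N : ℕ) → Measure (Fin N → Z × ℝ≥0)} (hL : IsConsistent γ L) {f : Z → ℝ}
    (hf : Measurable f) (hb : ∃ B : ℝ, ∀ z, |f z| ≤ B) {ε : ℝ} (hε : 0 < ε) :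
    Tendsto (fun N => L N {s | ε ≤ |(∑ I, ((s I).2 : ℝ))⁻¹ * ∑ J, f (s J).1 * ((s J).2 : ℝ) -
      (γ.real Set.univ)⁻¹ * ∫ z, f z ∂γ|}) atTop (𝓝 0) := by
  obtain ⟨δ, hδ, hmass⟩ := hL.mass
  obtain ⟨B, hB⟩ := hb
  set a := (γ.real Set.univ)⁻¹ * ∫ z, f z ∂γ with ha
  have hm : γ.real Set.univ ≠ 0 := by
    rw [measureReal_def, ENNReal.toReal_ne_zero]
    exact ⟨by simpa using hγ, measure_ne_top _ _⟩
  have hfi : Integrable f γ :=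
    (integrable_const B).mono' hf.aestronglyMeasurable (ae_of_all _ hB)
  have hlim := hmass.add (hL.conv (fun z => f z - a) (hf.sub_const a)
    ⟨B + |a|, fun z => (abs_sub _ _).trans (by gcongr; exact hB z)⟩ (by
      rw [integral_sub hfi (integrable_const a), integral_const, smul_eq_mul, ha]
      field_simp
      ring) (ε * δ) (by positivity))
  rw [add_zero] at hlim
  refine tendsto_of_tendsto_of_tendsto_of_le_of_le' tendsto_const_nhds hlim
    (Eventually.of_forall fun _ => zero_le) ?_
  filter_upwards [eventually_gt_atTop 0] with N hN
  have hN' : (0 : ℝ) < N := by exact_mod_cast hN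
  refine (measure_mono fun s hs => ?_).trans (measure_union_le _ _)
  by_contra hc
  simp only [Set.mem_union, Set.mem_ofPred_eq, not_or, not_lt, not_le] at hc hs
  obtain ⟨h1, h2⟩ := hc
  simp only [sub_mul, Finset.sum_sub_distrib, ← Finset.mul_sum] at h2
  set W := ∑ J, ((s J).2 : ℝ)
  have hW : 0 < W := lt_of_lt_of_le (by positivity) h1
  have h3 : W⁻¹ * ∑ J, f (s J).1 * ((s J).2 : ℝ) - a =
      (∑ J, f (s J).1 * ((s J).2 : ℝ) - a * W) / W := by field_simp
  rw [h3, abs_div, abs_of_pos hW, le_div_iff₀ hW] at hs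
  nlinarith

end ParticleSystems

/-! ### Direction and length of a projected Gaussian vector -/

section GaussianDirection

open scoped RealInnerProductSpace

variable {E : Type*} [NormedAddCommGroup E] [InnerProductSpace ℝ E]

/-- `D` is self-adjoint and fixes `v - w`, so it preserves both this line and its orthogonal
complement. -/
theorem apply_reflection_orthogonal_sub {D : E →L[ℝ] E} (hs : ∀ x y, ⟪D x, y⟫ = ⟪x, D y⟫) {v w : E}
    (hv : D v = v) (hw : D w = w) (x : E) :
    D ((ℝ ∙ (v - w))ᗮ.reflection x) = (ℝ ∙ (v - w))ᗮ.reflection (D x) := by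
  have hu : D (v - w) = v - w := by rw [map_sub, hv, hw]
  have hi : ⟪v - w, D x⟫ = ⟪v - w, x⟫ := by rw [← hs, hu]
  rw [Submodule.reflection_orthogonal_apply, Submodule.reflection_orthogonal_apply,
    Submodule.reflection_singleton_apply, Submodule.reflection_singleton_apply, hi]
  simp [hu]

/-- The direction of `D x`. -/
noncomputable def unitDir (D : E →L[ℝ] E) (x : E) : E := ‖D x‖⁻¹ • D x

variable [FiniteDimensional ℝ E] [MeasurableSpace E] [BorelSpace E]

theorem ae_stdGaussian_inner_ne_zero {u : E} (hu : u ≠ 0) :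
    ∀ᵐ x ∂stdGaussian E, ⟪u, x⟫ ≠ 0 := by
  have h := IsGaussian.map_eq_gaussianReal (μ := stdGaussian E) (innerSL ℝ u)
  have hv : Var[innerSL ℝ u; stdGaussian E] = ‖u‖ ^ 2 := by
    rw [variance_dual_stdGaussian, innerSL_apply_norm]
  have hv' : (Var[innerSL ℝ u; stdGaussian E]).toNNReal ≠ 0 := by
    rw [hv, Ne, Real.toNNReal_eq_zero, not_le]
    positivity
  have := nullSingletonClass_gaussianReal (μ := ∫ x, innerSL ℝ u x ∂stdGaussian E) hv'
  have h0 : (stdGaussian E).map (innerSL ℝ u) {0} = 0 := by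
    rw [h]
    exact measure_singleton 0
  rw [Measure.map_apply (by fun_prop) (measurableSet_singleton 0)] at h0
  rw [ae_iff]
  convert h0 using 2
  ext x
  simp

theorem measurable_unitDir (D : E →L[ℝ] E) : Measurable (unitDir D) := by
  unfold unitDir
  fun_prop

/-- Rotation invariance of the direction within the range of `D`: the reflection exchanging `v` and
`w` preserves the Gaussian law and commutes with `unitDir D`. -/
theorem integral_unitDir_eq_of_norm_eq {D : E →L[ℝ] E} (hs : ∀ x y, ⟪D x, y⟫ = ⟪x, D y⟫) {v w : E}
    (hv : D v = v) (hw : D w = w) (h : ‖v‖ = ‖w‖) {F : Type*} [NormedAddCommGroup F]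
    [NormedSpace ℝ F] (ψ : ℝ → F) :
    ∫ x, ψ ⟪unitDir D x, v⟫ ∂stdGaussian E = ∫ x, ψ ⟪unitDir D x, w⟫ ∂stdGaussian E := by
  set R := (ℝ ∙ (v - w))ᗮ.reflection with hR
  have hRv : R v = w := Submodule.reflection_sub h
  have hm : MeasurePreserving R (stdGaussian E) (stdGaussian E) :=
    ⟨R.continuous.measurable, stdGaussian_map R⟩
  conv_rhs => rw [← hm.integral_comp R.toHomeomorph.measurableEmbedding]
  congr with x
  congr 1
  have : unitDir D (R x) = R (unitDir D x) := by
    rw [unitDir, apply_reflection_orthogonal_sub hs hv hw, R.norm_map, unitDir, map_smul]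
  rw [this, ← hRv, R.inner_map_map]

/-- `P` and `A` are orthogonal projections with the range of `A` inside that of `P`; the direction
in the complement is taken from one Gaussian vector and everything else from an independent one. The
characteristic function is computed by exchanging the roles of the frequency `t` and the second
vector, so no explicit polar decomposition or chi law is needed. -/
theorem map_projection_add_norm_smul_unitDir {P A : E →L[ℝ] E}
    (hPs : ∀ x y, ⟪P x, y⟫ = ⟪x, P y⟫) (hPi : ∀ x, P (P x) = P x)
    (hAs : ∀ x y, ⟪A x, y⟫ = ⟪x, A y⟫) (hAi : ∀ x, A (A x) = A x) (hPA : ∀ x, P (A x) = A x) :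
    ((stdGaussian E).prod (stdGaussian E)).map
      (fun p => A p.2 + ‖(P - A) p.2‖ • unitDir (P - A) p.1) = (stdGaussian E).map P := by
  have hAP : ∀ x, A (P x) = A x := fun x => ext_inner_right ℝ fun y => by
    rw [hAs, hPs, hPA, ← hAs]
  set D := P - A with hD
  have hDs : ∀ x y, ⟪D x, y⟫ = ⟪x, D y⟫ := fun x y => by
    simp [hD, inner_sub_left, inner_sub_right, hPs, hAs]
  have hDi : ∀ x, D (D x) = D x := fun x => by simp [hD, hPi, hPA, hAP, hAi]
  have hAD : ∀ x, A (D x) = 0 := fun x => by simp [hD, hAP, hAi]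
  have hU := measurable_unitDir D
  have hDU : ∀ x, D (unitDir D x) = unitDir D x := fun x => by rw [unitDir, map_smul, hDi]
  have hm : Measurable fun p : E × E => A p.2 + ‖D p.2‖ • unitDir D p.1 := by fun_prop
  have hpyth : ∀ x y, D y = y → ‖A x + y‖ ^ 2 = ‖A x‖ ^ 2 + ‖y‖ ^ 2 := fun x y hy => by
    rw [sq, sq, sq, norm_add_sq_eq_norm_sq_add_norm_sq_real]
    rw [← hy, hAs, hAD, inner_zero_right]
  have hunit : ∀ t, ∀ᵐ x ∂stdGaussian E, ‖A t + ‖D t‖ • unitDir D x‖ ^ 2 = ‖P t‖ ^ 2 := by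
    intro t
    have hPt : ‖P t‖ ^ 2 = ‖A t‖ ^ 2 + ‖D t‖ ^ 2 := by
      rw [← hpyth t (D t) (hDi t)]; simp [hD]
    by_cases ht : D t = 0
    · rw [hPt]; simp [ht]
    · filter_upwards [ae_stdGaussian_inner_ne_zero ht] with x hx
      have hx' : D x ≠ 0 := fun h0 => hx (by rw [hDs, h0, inner_zero_right])
      rw [hpyth _ _ (by rw [map_smul, hDU]), hPt, norm_smul, unitDir, norm_smul]
      simp [hx']
  have : IsProbabilityMeasure ((stdGaussian E).map P) :=
    Measure.isProbabilityMeasure_map (by fun_prop)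
  have : IsProbabilityMeasure (((stdGaussian E).prod (stdGaussian E)).map
      (fun p => A p.2 + ‖D p.2‖ • unitDir D p.1)) :=
    Measure.isProbabilityMeasure_map hm.aemeasurable
  refine Measure.ext_of_charFun (funext fun t => ?_)
  have hint : ∀ φ : E × E → ℝ, Measurable φ → Integrable (fun p => Complex.exp (φ p * Complex.I))
      ((stdGaussian E).prod (stdGaussian E)) := fun φ hφ =>
    (integrable_const (1 : ℝ)).mono' (Measurable.aestronglyMeasurable (by fun_prop))
      (ae_of_all _ fun p => by rw [Complex.norm_exp_ofReal_mul_I])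
  have hR : charFun ((stdGaussian E).map P) t = Complex.exp (-‖P t‖ ^ 2 / 2) := by
    rw [charFun_apply, integral_map (by fun_prop) (Measurable.aestronglyMeasurable (by fun_prop))]
    simp only [hPs]
    rw [← charFun_apply, charFun_stdGaussian]
  rw [hR, charFun_apply, integral_map hm.aemeasurable
    (Measurable.aestronglyMeasurable (by fun_prop)),
    integral_prod_symm _ (hint (fun p => ⟪A p.2 + ‖D p.2‖ • unitDir D p.1, t⟫) (by fun_prop))]
  -- Here `‖D y‖ • D t` and `‖D t‖ • D y` have equal norms, so the random direction has the same law
  -- against both. Integrating `y` first then gives a Gaussian characteristic function at a vector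
  -- of norm `‖P t‖`, by `hunit`.
  have h1 : ∀ y, ∫ x, Complex.exp (⟪A y + ‖D y‖ • unitDir D x, t⟫ * Complex.I) ∂stdGaussian E =
      ∫ x, Complex.exp (⟪y, A t + ‖D t‖ • unitDir D x⟫ * Complex.I) ∂stdGaussian E := by
    intro y
    have h2 := integral_unitDir_eq_of_norm_eq hDs (v := ‖D y‖ • D t) (w := ‖D t‖ • D y)
      (by rw [map_smul, hDi]) (by rw [map_smul, hDi])
      (by simp [norm_smul, mul_comm]) fun r => Complex.exp ((⟪y, A t⟫ + r : ℝ) * Complex.I)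
    convert h2 using 5 with x x
    · rw [inner_add_left, hAs, inner_smul_left, inner_smul_right, ← hDs, hDU]
      rfl
    · rw [inner_add_right, inner_smul_right, inner_smul_right, ← hDs, hDU]
      rw [real_inner_comm (unitDir D x) y]
  simp only [h1]
  rw [← integral_prod_symm _ (hint (fun p => ⟪p.2, A t + ‖D t‖ • unitDir D p.1⟫) (by fun_prop)),
    integral_prod _ (hint (fun p => ⟪p.2, A t + ‖D t‖ • unitDir D p.1⟫) (by fun_prop))]
  simp only [← charFun_apply, charFun_stdGaussian]
  rw [integral_congr_ae (g := fun _ => Complex.exp (-‖P t‖ ^ 2 / 2))]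
  · simp
  · filter_upwards [hunit t] with x hx
    have := congrArg (fun r : ℝ => (r : ℂ)) hx
    push_cast at this
    rw [this]

end GaussianDirection

/-! ### Projections of sets given by closed and strict conditions -/

section ClosedPositive

variable {X Y ι : Type*} [TopologicalSpace X] [MeasurableSpace X] [BorelSpace X]
  [TopologicalSpace Y] [SigmaCompactSpace Y] [Finite ι]

/-- Finitely many strict inequalities hold exactly when all hold with a common margin `1 / (m + 1)`,
which is a closed condition. This fits the half-open data intervals. -/
theorem measurableSet_exists_mem_and_pos {A : Set (X × Y)} (hA : IsClosed A) {u : ι → X × Y → ℝ}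
    (hu : ∀ i, Continuous (u i)) : MeasurableSet {x | ∃ y, (x, y) ∈ A ∧ ∀ i, 0 < u i (x, y)} := by
  have : {x | ∃ y, (x, y) ∈ A ∧ ∀ i, 0 < u i (x, y)} =
      ⋃ m : ℕ, {x | ∃ y, (x, y) ∈ A ∩ {p | ∀ i, 1 / ((m : ℝ) + 1) ≤ u i p}} := by
    ext x
    simp only [Set.mem_ofPred_eq, Set.mem_iUnion, Set.mem_inter_iff]
    constructor
    · rintro ⟨y, hy, h⟩
      have h1 : ∀ i, ∀ᶠ m : ℕ in atTop, 1 / ((m : ℝ) + 1) < u i (x, y) := fun i =>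
        tendsto_one_div_add_atTop_nhds_zero_nat.eventually_lt_const (h i)
      obtain ⟨m, hm⟩ := (eventually_all.2 h1).exists
      exact ⟨m, y, hy, fun i => (hm i).le⟩
    · rintro ⟨m, y, hy, h⟩
      exact ⟨y, hy, fun i => lt_of_lt_of_le (by positivity) (h i)⟩
  rw [this]
  refine MeasurableSet.iUnion fun m => IsClosed.measurableSet_exists (hA.inter ?_)
  simp only [Set.ofPred_forall]
  exact isClosed_iInter fun i => isClosed_le continuous_const (hu i)

end ClosedPositive

/-! ### Importance weights for the truncated Cauchy law -/

section TruncatedCauchy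

open IntervalLMM (stdCauchy truncCauchy)

instance : IsProbabilityMeasure stdCauchy := by
  unfold stdCauchy
  infer_instance

theorem stdCauchy_eq_withDensity : stdCauchy = volume.withDensity (cauchyPDF 0 1) :=
  cauchyMeasure_of_scale_ne_zero 0 one_ne_zero

theorem volume_absolutelyContinuous_stdCauchy : volume ≪ stdCauchy := by
  rw [stdCauchy_eq_withDensity]
  refine withDensity_absolutelyContinuous' (by fun_prop) (ae_of_all _ fun x => ?_)
  rw [cauchyPDF_def, Ne, ENNReal.ofReal_eq_zero, not_le]
  exact cauchyPDF_pos 0 one_ne_zero x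

theorem isProbabilityMeasure_truncCauchy (A : Set ℝ) : IsProbabilityMeasure (truncCauchy A) := by
  unfold truncCauchy
  split_ifs with h
  · infer_instance
  · exact cond_isProbabilityMeasure h

/-- The mass of `I` cancels the normalization of the truncation, and `1 + x ^ 2` the Cauchy density,
leaving `exp (-x ^ 2 / 2) / π`. `F` need not be an interval, since the weight carries its indicator.
-/
theorem lintegral_truncCauchy {I F : Set ℝ} (hI : MeasurableSet I) (hF : MeasurableSet F)
    (hFI : volume (F \ I) = 0) {h : ℝ → ℝ≥0∞} (hh : Measurable h) :
    ∫⁻ x, F.indicator (fun x => ENNReal.ofReal (Real.exp (-x ^ 2 / 2) * (1 + x ^ 2) *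
      (stdCauchy I).toReal) * h x) x ∂truncCauchy I =
    ENNReal.ofReal (√(2 * Real.pi) / Real.pi) * ∫⁻ x, F.indicator h x ∂gaussianReal 0 1 := by
  have hg : gaussianReal 0 1 ≪ volume := gaussianReal_absolutelyContinuous 0 one_ne_zero
  have hdens : ∀ x, cauchyPDF 0 1 x * ENNReal.ofReal (Real.exp (-x ^ 2 / 2) * (1 + x ^ 2)) =
      ENNReal.ofReal (√(2 * Real.pi) / Real.pi) * gaussianPDF 0 1 x := by
    intro x
    rw [cauchyPDF_def, gaussianPDF, ← ENNReal.ofReal_mul (cauchyPDF_pos 0 one_ne_zero x).le,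
      ← ENNReal.ofReal_mul (by positivity), cauchyPDFReal_def, gaussianPDFReal]
    congr 1
    have h1 : √(2 * Real.pi) ≠ 0 := by positivity
    have h2 : x ^ 2 + 1 ≠ 0 := by positivity
    simp only [NNReal.coe_one, mul_one, sub_zero, one_pow]
    field_simp
    ring
  by_cases hp : stdCauchy I = 0
  · have hF0 : gaussianReal 0 1 F = 0 := by
      refine hg (measure_mono_null (fun x hx => ?_)
        (measure_union_null hFI (volume_absolutelyContinuous_stdCauchy hp)))
      by_cases hxI : x ∈ I
      · exact Or.inr hxI
      · exact Or.inl ⟨hx, hxI⟩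
    rw [lintegral_indicator hF h, Measure.restrict_eq_zero.2 hF0]
    simp [hp]
  · have hp' : stdCauchy I ≠ ∞ := measure_ne_top _ _
    set u : ℝ → ℝ≥0∞ := F.indicator fun x => ENNReal.ofReal (Real.exp (-x ^ 2 / 2) *
      (1 + x ^ 2) * (stdCauchy I).toReal) * h x with hu
    have hum : Measurable u := (Measurable.mul (by fun_prop) hh).indicator hF
    have hr : stdCauchy.restrict I = (volume.restrict I).withDensity (cauchyPDF 0 1) := by
      rw [stdCauchy_eq_withDensity, restrict_withDensity hI]
    rw [truncCauchy, if_neg hp, ProbabilityTheory.cond, lintegral_smul_measure, smul_eq_mul, hr,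
      lintegral_withDensity_eq_lintegral_mul _ (by fun_prop) hum]
    have h1 : ∀ x, (cauchyPDF 0 1 * u) x = stdCauchy I *
        (ENNReal.ofReal (√(2 * Real.pi) / Real.pi) * (gaussianPDF 0 1 * F.indicator h) x) := by
      intro x
      simp only [Pi.mul_apply, hu]
      by_cases hx : x ∈ F
      · rw [Set.indicator_of_mem hx, Set.indicator_of_mem hx, ENNReal.ofReal_mul (by positivity),
          ENNReal.ofReal_toReal hp', ← mul_assoc, ← mul_assoc, hdens]
        ring
      · simp [hx]
    have h2 : Measurable (gaussianPDF 0 1 * F.indicator h) :=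
      (measurable_gaussianPDF 0 1).mul (hh.indicator hF)
    simp only [h1]
    rw [lintegral_const_mul _ (h2.const_mul _), ← mul_assoc, ENNReal.inv_mul_cancel hp hp', one_mul,
      lintegral_const_mul _ h2, gaussianReal_of_var_ne_zero 0 one_ne_zero,
      lintegral_withDensity_eq_lintegral_mul _ (by fun_prop) (hh.indicator hF)]
    congr 1
    rw [← lintegral_indicator hI]
    refine lintegral_congr_ae ?_
    filter_upwards [measure_eq_zero_iff_ae_notMem.1 hFI] with x hx
    by_cases hxI : x ∈ I
    · simp [hxI]
    · have : x ∉ F := fun hxF => hx ⟨hxF, hxI⟩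
      simp [hxI, this]

end TruncatedCauchy

/-! ### Feasible sets and coordinatewise Gaussian refreshment -/

namespace IntervalLMM

variable {n p q : ℕ} (M : IntervalLMM n p q)

theorem continuous_fit (k : Fin n) :
    Continuous fun x : M.State × M.Param => M.fit x.2 x.1 k := by
  unfold fit
  fun_prop

theorem continuous_setErr (k : Fin n) :
    Continuous fun x : M.State × ℝ => M.setErr k x.1 x.2 := by
  unfold setErr
  fun_prop

theorem isClosed_fit_le (t : ℕ) :
    IsClosed {x : M.State × M.Param | ∀ k : Fin n, (k : ℕ) < t → M.fit x.2 x.1 k ≤ M.b k} := by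
  simp only [Set.ofPred_forall]
  exact isClosed_iInter fun k => isClosed_iInter fun _ =>
    isClosed_le (M.continuous_fit k) continuous_const

theorem measurableSet_C (t : ℕ) : MeasurableSet (M.C t) := by
  have h := measurableSet_exists_mem_and_pos (M.isClosed_fit_le t) (ι := {k : Fin n // (k : ℕ) < t})
    (u := fun k x => M.fit x.2 x.1 k - M.a k)
    fun k => (M.continuous_fit k).sub continuous_const
  convert h using 1
  ext z
  simp only [C, Set.Nonempty, Q, Set.mem_ofPred_eq, sub_pos, Subtype.forall]
  exact exists_congr fun θ => ⟨fun H => ⟨fun k hk => (H k hk).2, fun k hk => (H k hk).1⟩,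
    fun H k hk => ⟨H.2 k hk, H.1 k hk⟩⟩

theorem C_anti {s t : ℕ} (h : s ≤ t) : M.C t ⊆ M.C s :=
  fun _ ⟨θ, hθ⟩ => ⟨θ, fun k hk => hθ k (hk.trans_le h)⟩

theorem fit_congr {t : ℕ} {z z' : M.State} (h : ∀ i j, M.Introduced t i j → z i j = z' i j)
    (θ : M.Param) {k : Fin n} (hk : (k : ℕ) < t) : M.fit θ z k = M.fit θ z' k := by
  unfold fit
  congr 1
  refine Finset.sum_congr rfl fun i _ => ?_
  congr 1
  refine Finset.sum_congr rfl fun j _ => ?_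
  by_cases hV : M.V i k j = 0
  · simp [hV]
  · rw [h i j ⟨k, hk, hV⟩]

theorem mem_C_congr {t : ℕ} {z z' : M.State} (h : ∀ i j, M.Introduced t i j → z i j = z' i j) :
    z ∈ M.C t ↔ z' ∈ M.C t := by
  refine exists_congr fun θ => forall₂_congr fun k hk => ?_
  rw [M.fit_congr h θ hk]

theorem introduced_last_iff {t : ℕ} {j : Fin (M.l (Fin.last q))} :
    M.Introduced t (Fin.last q) j ↔ (j : ℕ) < t := by
  constructor
  · rintro ⟨k, hk, h⟩
    rw [M.V_error] at h
    have : (k : ℕ) = j := by by_contra hne; simp [hne] at h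
    omega
  · intro h
    refine ⟨Fin.cast M.l_error j, by simpa using h, ?_⟩
    rw [M.V_error]
    simp

theorem Introduced.mono {s t : ℕ} (h : s ≤ t) {i : Fin (q + 1)} {j : Fin (M.l i)}
    (H : M.Introduced s i j) : M.Introduced t i j :=
  let ⟨k, hk, hV⟩ := H
  ⟨k, hk.trans_le h, hV⟩

/-- The components in `P` are replaced by those of `g`. -/
noncomputable def merge (P : (i : Fin (q + 1)) → Fin (M.l i) → Prop) (z g : M.State) : M.State :=
  fun i j => if P i j then g i j else z i j

/-- The law of independent standard normal components in `P`, the others being kept. -/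
noncomputable def mergeLaw (P : (i : Fin (q + 1)) → Fin (M.l i) → Prop) (z : M.State) : Measure M.State :=
  Measure.pi fun i => Measure.pi fun j => if P i j then gaussianReal 0 1 else Measure.dirac (z i j)

/-- The law of independent standard normal components. -/
noncomputable def gaussState : Measure M.State := Measure.pi fun _ => Measure.pi fun _ => gaussianReal 0 1

instance : IsProbabilityMeasure M.gaussState := by
  unfold gaussState
  infer_instance

instance isProbabilityMeasure_ite_gaussianReal_dirac (c : Prop) (x : ℝ) :
    IsProbabilityMeasure (if c then gaussianReal 0 1 else Measure.dirac x) := by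
  split_ifs <;> infer_instance

instance (P : (i : Fin (q + 1)) → Fin (M.l i) → Prop) (z : M.State) :
    IsProbabilityMeasure (M.mergeLaw P z) := by
  unfold mergeLaw
  infer_instance

theorem map_ite_gaussianReal (c : Prop) (x : ℝ) :
    (gaussianReal 0 1).map (fun y => if c then y else x) =
      if c then gaussianReal 0 1 else Measure.dirac x := by
  by_cases h : c <;> simp [h]

theorem mergeLaw_eq_map (P : (i : Fin (q + 1)) → Fin (M.l i) → Prop) (z : M.State) :
    M.mergeLaw P z = M.gaussState.map (M.merge P z) := by
  have hi : ∀ i j, IsProbabilityMeasure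
      ((gaussianReal 0 1).map (fun y => if P i j then y else z i j)) := fun i j => by
    rw [map_ite_gaussianReal]
    infer_instance
  have h1 : ∀ i, (Measure.pi fun _ : Fin (M.l i) => gaussianReal 0 1).map
      (fun g j => if P i j then g j else z i j) =
      Measure.pi fun j => if P i j then gaussianReal 0 1 else Measure.dirac (z i j) := fun i => by
    rw [Measure.pi_map_pi (f := fun j y => if P i j then y else z i j) fun j => by
      split_ifs <;> fun_prop]
    simp only [map_ite_gaussianReal]
  have hi' : ∀ i, IsProbabilityMeasure ((Measure.pi fun _ : Fin (M.l i) => gaussianReal 0 1).map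
      (fun g j => if P i j then g j else z i j)) := fun i => by
    rw [h1]
    infer_instance
  unfold mergeLaw gaussState merge
  simp only [← h1]
  rw [← Measure.pi_map_pi]
  exact fun i => (measurable_pi_lambda _ fun j => by split_ifs <;> fun_prop).aemeasurable

theorem measurable_merge (P : (i : Fin (q + 1)) → Fin (M.l i) → Prop) :
    Measurable (Function.uncurry (M.merge P)) := by
  refine measurable_pi_lambda _ fun i => measurable_pi_lambda _ fun j => ?_
  simp only [Function.uncurry, merge]
  split_ifs <;> fun_prop

theorem measurable_merge_left (P : (i : Fin (q + 1)) → Fin (M.l i) → Prop) (z : M.State) :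
    Measurable (M.merge P z) :=
  (M.measurable_merge P).comp measurable_prodMk_left

theorem measurable_mergeLaw (P : (i : Fin (q + 1)) → Fin (M.l i) → Prop) :
    Measurable (M.mergeLaw P) := by
  simp only [funext (M.mergeLaw_eq_map P)]
  exact measurable_measure_map_const (M.measurable_merge P)

theorem measurable_ite_gaussianReal_dirac (c : Prop) :
    Measurable fun x : ℝ => if c then gaussianReal 0 1 else Measure.dirac x := by
  split_ifs
  · exact measurable_const
  · exact Measure.measurable_dirac

/-- Coordinatewise, a refreshed component stays standard normal when kept or refreshed again.
Targets before conditioning and Gaussian proposals all have this form, so composing them is taking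
unions of index sets. -/
theorem mergeLaw_bind_mergeLaw (P P' : (i : Fin (q + 1)) → Fin (M.l i) → Prop) (z : M.State) :
    (M.mergeLaw P z).bind (M.mergeLaw P') = M.mergeLaw (fun i j => P i j ∨ P' i j) z := by
  have h1 : ∀ i j, (if P i j then gaussianReal 0 1 else Measure.dirac (z i j)).bind
      (fun x => if P' i j then gaussianReal 0 1 else Measure.dirac x) =
      if P i j ∨ P' i j then gaussianReal 0 1 else Measure.dirac (z i j) := by
    intro i j
    by_cases h' : P' i j
    · simp [h']
    · simp [h', Measure.bind_dirac]
  have h2 : ∀ i, (Measure.pi fun j => if P i j then gaussianReal 0 1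
        else Measure.dirac (z i j)).bind
      (fun y => Measure.pi fun j => if P' i j then gaussianReal 0 1 else Measure.dirac (y j)) =
      Measure.pi fun j => if P i j ∨ P' i j then gaussianReal 0 1 else Measure.dirac (z i j) := by
    intro i
    rw [Measure.pi_bind_pi (κ := fun j x => if P' i j then gaussianReal 0 1 else Measure.dirac x)
      fun j => measurable_ite_gaussianReal_dirac _]
    simp only [h1]
  unfold mergeLaw
  refine (Measure.pi_bind_pi (κ := fun i (y : Fin (M.l i) → ℝ) => Measure.pi fun j =>
    if P' i j then gaussianReal 0 1 else Measure.dirac (y j)) fun i => ?_).trans ?_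
  · exact measurable_measure_pi (κ := fun j (y : Fin (M.l i) → ℝ) =>
      if P' i j then gaussianReal 0 1 else Measure.dirac (y j)) fun j =>
      (measurable_ite_gaussianReal_dirac _).comp (measurable_pi_apply j)
  · congr 1
    funext i
    exact (h2 i).trans (by congr!)

theorem nonErrProposal_eq_mergeLaw (k : Fin n) : M.nonErrProposal k =
    M.mergeLaw fun i j => i ≠ Fin.last q ∧ M.Introduced (k + 1) i j ∧ ¬ M.Introduced k i j := by
  funext z
  unfold nonErrProposal mergeLaw
  congr!

theorem pi_gaussEffect_eq_mergeLaw (t : ℕ) :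
    (Measure.pi fun i => M.gaussEffect t i) = M.mergeLaw (M.Introduced t) 0 := rfl

instance (t : ℕ) (i : Fin (q + 1)) : IsProbabilityMeasure (M.gaussEffect t i) := by
  unfold gaussEffect
  infer_instance

theorem map_setErr_gaussianReal (k : Fin n) (z : M.State) :
    (gaussianReal 0 1).map (M.setErr k z) =
      M.mergeLaw (fun i j => i = Fin.last q ∧ (j : ℕ) = k) z := by
  have h : M.merge (fun i j => i = Fin.last q ∧ (j : ℕ) = k) z =
      M.setErr k z ∘ fun g => g (Fin.last q) (M.errLevel k) := by
    funext g i j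
    simp only [merge, setErr, Function.comp]
    by_cases hi : i = Fin.last q
    · subst hi
      by_cases hj : j = M.errLevel k
      · subst hj
        simp [errLevel]
      · have : (j : ℕ) ≠ k := fun hjk => hj (Fin.ext (by simpa [errLevel] using hjk))
        simp [hj, this]
    · simp [hi]
  have h2 : M.gaussState.map (fun g => g (Fin.last q) (M.errLevel k)) = gaussianReal 0 1 :=
    ((measurePreserving_eval (fun _ => gaussianReal 0 1) (M.errLevel k)).comp
      (measurePreserving_eval (fun i => Measure.pi fun _ : Fin (M.l i) => gaussianReal 0 1)
        (Fin.last q))).map_eq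
  rw [mergeLaw_eq_map, h, ← Measure.map_map _ (by fun_prop), h2]
  exact (M.continuous_setErr k).measurable.comp measurable_prodMk_left

/-- The error design is the identity, so datum `k` introduces exactly one error component; the two
draws together refresh all new components. -/
theorem nonErrProposal_bind_map_setErr (k : Fin n) (z : M.State) :
    (M.nonErrProposal k z).bind (fun z' => (gaussianReal 0 1).map (M.setErr k z')) =
      M.mergeLaw (fun i j => M.Introduced (k + 1) i j ∧ ¬ M.Introduced k i j) z := by
  simp only [map_setErr_gaussianReal, nonErrProposal_eq_mergeLaw]
  rw [mergeLaw_bind_mergeLaw]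
  congr with i j
  by_cases hi : i = Fin.last q
  · subst hi
    simp only [introduced_last_iff]
    simp
    omega
  · simp [hi]

theorem mergeLaw_introduced_bind (k : ℕ) : (M.mergeLaw (M.Introduced k) 0).bind
    (M.mergeLaw fun i j => M.Introduced (k + 1) i j ∧ ¬ M.Introduced k i j) =
      M.mergeLaw (M.Introduced (k + 1)) 0 := by
  rw [mergeLaw_bind_mergeLaw]
  congr with i j
  have := Introduced.mono M (Nat.le_succ k) (i := i) (j := j)
  tauto

/-- New components do not enter the earlier equations, so a particle outside `C k` can never reach
`C (k + 1)`. -/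
theorem mergeLaw_C_eq_zero {k : ℕ} {z : M.State} (hz : z ∉ M.C k) :
    M.mergeLaw (fun i j => M.Introduced (k + 1) i j ∧ ¬ M.Introduced k i j) z (M.C (k + 1)) = 0 := by
  rw [mergeLaw_eq_map, Measure.map_apply (M.measurable_merge_left _ z) (M.measurableSet_C _)]
  convert measure_empty (μ := M.gaussState)
  refine Set.eq_empty_of_forall_notMem fun g hg => hz ?_
  refine (M.mem_C_congr fun i j h => ?_).1 (M.C_anti (Nat.le_succ k) hg)
  simp [merge, h]

/-! ### The proposal -/

theorem setErr_setErr (k : Fin n) (z : M.State) (x y : ℝ) :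
    M.setErr k (M.setErr k z x) y = M.setErr k z y := by
  simp [setErr]

theorem setErr_apply_errLevel (k : Fin n) (z : M.State) (x : ℝ) :
    M.setErr k z x (Fin.last q) (M.errLevel k) = x := by
  simp [setErr]

theorem setErr_apply_of_introduced (k : Fin n) (z : M.State) (x : ℝ) {i : Fin (q + 1)}
    {j : Fin (M.l i)} (h : M.Introduced k i j) : M.setErr k z x i j = z i j := by
  unfold setErr
  by_cases hi : i = Fin.last q
  · subst hi
    rw [introduced_last_iff] at h
    have : j ≠ M.errLevel k := by
      rintro rfl
      simp [errLevel] at h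
    simp [this]
  · simp [hi]

/-- The error component of datum `k` occurs in no earlier equation, so changing it does not affect
`Q k`. -/
theorem mem_feasibleErr_iff (k : Fin n) (z : M.State) (x : ℝ) :
    x ∈ M.feasibleErr k z ↔ M.setErr k z x ∈ M.C (k + 1) := by
  have h : ∀ θ (k' : Fin n), (k' : ℕ) < k → M.fit θ (M.setErr k z x) k' = M.fit θ z k' :=
    fun θ k' hk' => M.fit_congr (fun i j => M.setErr_apply_of_introduced k z x) θ hk'
  refine exists_congr fun θ => ?_
  simp only [Q, Set.mem_ofPred_eq]
  constructor
  · rintro ⟨h1, h2⟩ k' hk'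
    rcases Nat.lt_succ_iff_lt_or_eq.1 hk' with h3 | h3
    · rw [h θ k' h3]
      exact h1 k' h3
    · rw [Fin.ext h3]
      exact h2
  · intro H
    refine ⟨fun k' hk' => ?_, H k (Nat.lt_succ_self _)⟩
    rw [← h θ k' hk']
    exact H k' (hk'.trans (Nat.lt_succ_self _))

theorem feasibleErr_setErr (k : Fin n) (z : M.State) (x : ℝ) :
    M.feasibleErr k (M.setErr k z x) = M.feasibleErr k z := by
  ext y
  rw [mem_feasibleErr_iff, mem_feasibleErr_iff, setErr_setErr]

theorem interval_setErr (k : Fin n) (z : M.State) (x : ℝ) :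
    M.interval k (M.setErr k z x) = M.interval k z := by
  simp only [interval, lower, upper, feasibleErr_setErr]

theorem mem_interval_iff (k : Fin n) (z : M.State) (x : ℝ) :
    x ∈ M.interval k z ↔ (∃ y ∈ M.feasibleErr k z, y < x) ∧ ∃ y ∈ M.feasibleErr k z, x < y := by
  simp only [interval, lower, upper, Set.mem_ofPred_eq, sInf_lt_iff, lt_sSup_iff,
    Set.exists_mem_image, EReal.coe_lt_coe_iff]

theorem measurableSet_mem_interval (k : Fin n) :
    MeasurableSet {y : M.State × ℝ | y.2 ∈ M.interval k y.1} := by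
  have hc : Continuous fun y : (M.State × ℝ) × (ℝ × M.Param) =>
      (M.setErr k y.1.1 y.2.1, y.2.2) :=
    ((M.continuous_setErr k).comp (by fun_prop : Continuous
      fun y : (M.State × ℝ) × (ℝ × M.Param) => (y.1.1, y.2.1))).prodMk (by fun_prop)
  -- The signs `c = 1` and `c = -1` treat the lower and the upper end at once.
  have key : ∀ c : ℝ, MeasurableSet {y : M.State × ℝ | ∃ x ∈ M.feasibleErr k y.1,
      c * x < c * y.2} := by
    intro c
    have h := measurableSet_exists_mem_and_pos ((M.isClosed_fit_le (k + 1)).preimage hc)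
      (ι := Option {k' : Fin n // (k' : ℕ) < k + 1})
      (u := fun o y => o.elim (c * y.1.2 - c * y.2.1)
        fun k' => M.fit y.2.2 (M.setErr k y.1.1 y.2.1) k' - M.a k') (by
        rintro (_ | k')
        · simp only [Option.elim]
          fun_prop
        · exact ((M.continuous_fit k').comp hc).sub continuous_const)
    convert h using 1
    ext y
    simp only [mem_feasibleErr_iff, C, Q, Set.Nonempty, Set.mem_ofPred_eq, Set.mem_preimage,
      Option.forall, Option.elim, sub_pos, Subtype.forall]
    constructor
    · rintro ⟨x, ⟨θ, hθ⟩, hx⟩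
      exact ⟨(x, θ), fun k' h' => (hθ k' h').2, hx, fun k' h' => (hθ k' h').1⟩
    · rintro ⟨⟨x, θ⟩, h1, hx, h2⟩
      exact ⟨x, ⟨θ, fun k' h' => ⟨h2 k' h', h1 k' h'⟩⟩, hx⟩
  convert (key 1).inter (key (-1)) using 1
  ext y
  simp only [mem_interval_iff, Set.mem_inter_iff, Set.mem_ofPred_eq, one_mul, neg_mul, neg_lt_neg_iff]

theorem measurableSet_interval (k : Fin n) (z : M.State) : MeasurableSet (M.interval k z) :=
  measurable_prodMk_left (x := z) (M.measurableSet_mem_interval k)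

theorem measurable_stdCauchy_interval (k : Fin n) :
    Measurable fun z => stdCauchy (M.interval k z) :=
  measurable_measure_prodMk_left (M.measurableSet_mem_interval k)

theorem measurableSet_feasibleErr (k : Fin n) (z : M.State) : MeasurableSet (M.feasibleErr k z) := by
  have : M.feasibleErr k z = M.setErr k z ⁻¹' M.C (k + 1) := by
    ext x
    exact M.mem_feasibleErr_iff k z x
  rw [this]
  exact ((M.continuous_setErr k).measurable.comp measurable_prodMk_left) (M.measurableSet_C _)

/-- A feasible value outside the open interval is the least or the greatest one, so at most two
points are lost. -/
theorem volume_feasibleErr_diff_interval (k : Fin n) (z : M.State) :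
    volume (M.feasibleErr k z \ M.interval k z) = 0 := by
  refine measure_mono_null (t := {x | IsLeast (M.feasibleErr k z) x} ∪
    {x | IsGreatest (M.feasibleErr k z) x}) ?_ (measure_union_null ?_ ?_)
  · rintro x ⟨hx, hx'⟩
    rw [mem_interval_iff, not_and_or] at hx'
    rcases hx' with h | h
    · push Not at h
      exact Or.inl ⟨hx, h⟩
    · push Not at h
      exact Or.inr ⟨hx, h⟩
  · exact Set.Subsingleton.measure_zero (fun x hx y hy => hx.unique hy) _
  · exact Set.Subsingleton.measure_zero (fun x hx y hy => hx.unique hy) _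

instance (k : Fin n) (z : M.State) : IsProbabilityMeasure (M.errProposal k z) := by
  unfold errProposal
  split_ifs
  · exact isProbabilityMeasure_truncCauchy _
  · infer_instance

theorem measurable_errProposal (k : Fin n) : Measurable (M.errProposal k) := by
  unfold errProposal
  split_ifs
  · unfold truncCauchy
    refine Measurable.ite (M.measurable_stdCauchy_interval k (measurableSet_singleton 0))
      measurable_const ?_
    refine Measure.measurable_of_measurable_coe _ fun A hA => ?_
    simp only [cond_apply' hA]
    refine (M.measurable_stdCauchy_interval k).inv.mul ?_
    exact measurable_measure_prodMk_left
      ((M.measurableSet_mem_interval k).inter (measurable_snd hA))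
  · exact measurable_const

theorem measurable_errProposal_map_setErr (k : Fin n) :
    Measurable fun z => (M.errProposal k z).map (M.setErr k z) :=
  measurable_measure_map_uncurry (M.measurable_errProposal k) (M.continuous_setErr k).measurable

theorem isProbabilityMeasure_errProposal_map_setErr (k : Fin n) (z : M.State) :
    IsProbabilityMeasure ((M.errProposal k z).map (M.setErr k z)) :=
  Measure.isProbabilityMeasure_map
    ((M.continuous_setErr k).measurable.comp measurable_prodMk_left).aemeasurable

instance (k : Fin n) (z : M.State) : IsProbabilityMeasure (M.proposal k z) := by
  have := M.isProbabilityMeasure_errProposal_map_setErr k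
  have : IsProbabilityMeasure (M.nonErrProposal k z) := by
    rw [nonErrProposal_eq_mergeLaw]
    infer_instance
  exact isProbabilityMeasure_bind (M.measurable_errProposal_map_setErr k).aemeasurable
    (ae_of_all _ fun _ => inferInstance)

theorem measurable_proposal (k : Fin n) : Measurable (M.proposal k) := by
  unfold proposal
  simp only [nonErrProposal_eq_mergeLaw]
  exact (Measure.measurable_bind' (M.measurable_errProposal_map_setErr k)).comp
    (M.measurable_mergeLaw _)

theorem measurable_weightFactor (k : Fin n) : Measurable (M.weightFactor k) := by
  unfold weightFactor
  refine Measurable.ite (M.measurableSet_C _) ?_ measurable_const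
  split_ifs
  · have := (M.measurable_stdCauchy_interval k).ennreal_toReal
    fun_prop
  · exact measurable_const

theorem weightFactor_le (k : Fin n) (z : M.State) : M.weightFactor k z ≤ 2 := by
  unfold weightFactor
  split_ifs
  · refine Real.toNNReal_le_iff_le_coe.2 ?_
    set x := z (Fin.last q) (M.errLevel k)
    have h1 : (stdCauchy (M.interval k z)).toReal ≤ 1 := by
      rw [← ENNReal.toReal_one]
      exact ENNReal.toReal_mono ENNReal.one_ne_top prob_le_one
    -- From `1 + x ^ 2 / 2 ≤ exp (x ^ 2 / 2)`, since `1 + x ^ 2 ≤ 2 * (1 + x ^ 2 / 2)`.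
    have h2 : Real.exp (-x ^ 2 / 2) * (1 + x ^ 2) ≤ 2 := by
      have h3 := Real.add_one_le_exp (x ^ 2 / 2)
      have h4 : Real.exp (-x ^ 2 / 2) * Real.exp (x ^ 2 / 2) = 1 := by
        rw [← Real.exp_add]
        ring_nf
        simp
      nlinarith [Real.exp_pos (-x ^ 2 / 2)]
    calc _ ≤ (2 : ℝ) * 1 := mul_le_mul h2 h1 ENNReal.toReal_nonneg zero_le_two
      _ = ((2 : ℝ≥0) : ℝ) := by norm_num
  · norm_num
  · exact zero_le

/-- The proportionality constant in the incremental weight of datum `k`. -/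
noncomputable def weightConst (k : Fin n) : ℝ := if M.Late k then √(2 * Real.pi) / Real.pi else 1

theorem weightConst_pos (k : Fin n) : 0 < M.weightConst k := by
  unfold weightConst
  split_ifs <;> positivity

/-- After reweighting, early and late proposals alike act as an `N(0,1)` draw restricted to `C (k +
1)`, up to a constant. The interval in the weight is read off after the draw, harmlessly by
`interval_setErr`. -/
theorem lintegral_errProposal (k : Fin n) (z : M.State) {h : M.State → ℝ≥0∞} (hh : Measurable h) :
    ∫⁻ x, M.weightFactor k x * h x ∂(M.errProposal k z).map (M.setErr k z) =
      ENNReal.ofReal (M.weightConst k) *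
        ∫⁻ x, (M.C (k + 1)).indicator h x ∂(gaussianReal 0 1).map (M.setErr k z) := by
  have hs : Measurable (M.setErr k z) :=
    (M.continuous_setErr k).measurable.comp measurable_prodMk_left
  have hwh : Measurable fun x => M.weightFactor k x * h x :=
    (M.measurable_weightFactor k).coe_nnreal_ennreal.mul hh
  rw [lintegral_map hwh hs,
    lintegral_map (hh.indicator (M.measurableSet_C _)) hs]
  have h2 : ∀ x, (M.C (k + 1)).indicator h (M.setErr k z x) =
      (M.feasibleErr k z).indicator (fun x => h (M.setErr k z x)) x := by
    intro x
    simp only [Set.indicator, mem_feasibleErr_iff]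
  simp only [h2]
  by_cases hL : M.Late k
  · have h3 := lintegral_truncCauchy (M.measurableSet_interval k z)
      (M.measurableSet_feasibleErr k z) (M.volume_feasibleErr_diff_interval k z) (hh.comp hs)
    simp only [Function.comp_def] at h3
    rw [weightConst, if_pos hL, errProposal, if_pos hL, ← h3]
    congr with x
    simp only [weightFactor, Set.indicator, ← mem_feasibleErr_iff, if_pos hL, interval_setErr,
      setErr_apply_errLevel]
    split_ifs
    · rfl
    · simp
  · rw [weightConst, if_neg hL, errProposal, if_neg hL, ENNReal.ofReal_one, one_mul]
    congr with x
    simp only [weightFactor, Set.indicator, ← mem_feasibleErr_iff, if_neg hL]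
    split_ifs <;> simp

/-- The unnormalized target. -/
noncomputable def unnormTarget (t : ℕ) : Measure M.State := (M.mergeLaw (M.Introduced t) 0).restrict (M.C t)

instance (t : ℕ) : IsFiniteMeasure (M.unnormTarget t) := by
  unfold unnormTarget
  infer_instance

theorem target_eq_smul (t : ℕ) : M.target t = (M.unnormTarget t Set.univ)⁻¹ • M.unnormTarget t := by
  rw [target, pi_gaussEffect_eq_mergeLaw, ProbabilityTheory.cond, unnormTarget,
    Measure.restrict_apply_univ]

theorem withDensity_unnormTarget_bind_proposal (k : Fin n) :
    ((M.unnormTarget k).bind (M.proposal k)).withDensity (fun z => M.weightFactor k z) =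
      ENNReal.ofReal (M.weightConst k) • M.unnormTarget (k + 1) := by
  ext A hA
  have hw := (M.measurable_weightFactor k).coe_nnreal_ennreal
  have h1 : ∀ z, A.indicator (fun z => (M.weightFactor k z : ℝ≥0∞)) z =
      M.weightFactor k z * A.indicator 1 z := fun z => by
    by_cases hz : z ∈ A <;> simp [hz]
  have hAm : Measurable (A.indicator (1 : M.State → ℝ≥0∞)) := measurable_one.indicator hA
  have hwA : Measurable fun x => (M.weightFactor k x : ℝ≥0∞) * A.indicator 1 x := hw.mul hAm
  have hC := (M.measurableSet_C (k + 1)).inter hA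
  have h2 : (M.C (k + 1)).indicator (A.indicator (1 : M.State → ℝ≥0∞)) =
      (M.C (k + 1) ∩ A).indicator 1 := Set.indicator_indicator _ _ _
  set R := M.mergeLaw fun i j => M.Introduced (k + 1) i j ∧ ¬ M.Introduced k i j with hR
  have hRm : Measurable R := M.measurable_mergeLaw _
  have h3 : ∀ z, ∫⁻ x, M.weightFactor k x * A.indicator 1 x ∂M.proposal k z =
      ENNReal.ofReal (M.weightConst k) * R z (M.C (k + 1) ∩ A) := by
    intro z
    have hg : Measurable fun z' => (gaussianReal 0 1).map (M.setErr k z') :=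
      measurable_measure_map_const (M.continuous_setErr k).measurable
    have hgi : Measurable fun z' => ∫⁻ x, (M.C (k + 1) ∩ A).indicator 1 x
        ∂(gaussianReal 0 1).map (M.setErr k z') :=
      (Measure.measurable_lintegral (measurable_one.indicator hC)).comp hg
    rw [proposal, Measure.lintegral_bind (M.measurable_errProposal_map_setErr k).aemeasurable
      hwA.aemeasurable]
    simp only [M.lintegral_errProposal k _ hAm, h2]
    rw [lintegral_const_mul _ hgi,
      ← Measure.lintegral_bind hg.aemeasurable (measurable_one.indicator hC).aemeasurable,
      nonErrProposal_bind_map_setErr, lintegral_indicator_one hC]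
  have hRC : Measurable fun z => R z (M.C (k + 1) ∩ A) := (Measure.measurable_coe hC).comp hRm
  rw [withDensity_apply _ hA, ← lintegral_indicator hA]
  simp only [h1]
  rw [Measure.lintegral_bind (M.measurable_proposal k).aemeasurable hwA.aemeasurable]
  simp only [h3]
  rw [lintegral_const_mul _ hRC, Measure.smul_apply, smul_eq_mul, unnormTarget, unnormTarget,
    Measure.restrict_apply hA, Set.inter_comm A, ← mergeLaw_introduced_bind,
    Measure.bind_apply hC hRm.aemeasurable, ← lintegral_indicator (M.measurableSet_C _)]
  congr with z
  -- Restricting the starting point to `C k` costs nothing, because the other starting points miss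
  -- `C (k + 1)`.
  by_cases hz : z ∈ M.C k
  · simp [hz, hR]
  · rw [Set.indicator_of_notMem hz]
    exact (measure_mono_null Set.inter_subset_left (M.mergeLaw_C_eq_zero hz)).symm

theorem integral_proposal (k : Fin n) {g : M.State → ℝ} (hg : Measurable g)
    (hb : ∃ B, ∀ z, |g z| ≤ B) :
    ∫ z, ∫ z', g z' * M.weightFactor k z' ∂M.proposal k z ∂M.unnormTarget k =
      M.weightConst k * ∫ z, g z ∂M.unnormTarget (k + 1) := by
  obtain ⟨B, hB⟩ := hb
  have hw := M.measurable_weightFactor k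
  rw [← integral_bind_of_bounded (M.measurable_proposal k) (B := B * 2) (by fun_prop) fun z => ?_]
  · have h := congrArg (fun μ => ∫ z, g z ∂μ) (M.withDensity_unnormTarget_bind_proposal k)
    simp only [integral_smul_measure, integral_withDensity_eq_integral_smul hw,
      ENNReal.toReal_ofReal (M.weightConst_pos k).le, smul_eq_mul] at h
    rw [← h]
    congr with z
    rw [NNReal.smul_def, smul_eq_mul, mul_comm]
  · rw [abs_mul, NNReal.abs_eq]
    exact mul_le_mul (hB z) (by exact_mod_cast M.weightFactor_le k z) (NNReal.coe_nonneg _)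
      ((abs_nonneg _).trans (hB z))

theorem fit_single_last (z : M.State) (k : Fin n) :
    M.fit (0, Pi.single (Fin.last q) 1) z k = z (Fin.last q) (M.errLevel k) := by
  have h : ∀ j : Fin (M.l (Fin.last q)), (k : ℕ) = j ↔ M.errLevel k = j := fun j => by
    rw [Fin.ext_iff]
    rfl
  simp [fit, Pi.single_apply, M.V_error, h]

theorem gaussianReal_Ioc_pos {a b : ℝ} (h : a < b) : gaussianReal 0 1 (Set.Ioc a b) ≠ 0 := by
  intro h0
  have := gaussianReal_absolutelyContinuous' 0 one_ne_zero h0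
  rw [Real.volume_Ioc, ENNReal.ofReal_eq_zero] at this
  linarith

/-- With `β = 0`, `σ` equal to one for the error and zero otherwise, the equations say that each
error lies in its data interval. This box has positive Gaussian mass because `a k < b k`. -/
theorem unnormTarget_ne_zero (t : ℕ) : M.unnormTarget t ≠ 0 := by
  let s : (i : Fin (q + 1)) → Fin (M.l i) → Set ℝ := fun i j =>
    {x | i = Fin.last q → (j : ℕ) < t → ∀ k : Fin n, (k : ℕ) = j → M.a k < x ∧ x ≤ M.b k}
  have hs : (Set.univ.pi fun i => Set.univ.pi (s i)) ⊆ M.C t := by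
    intro z hz
    refine ⟨(0, Pi.single (Fin.last q) 1), fun k hk => ?_⟩
    rw [fit_single_last]
    exact hz (Fin.last q) trivial (M.errLevel k) trivial rfl hk k rfl
  intro h0
  rw [unnormTarget, Measure.restrict_eq_zero] at h0
  have h1 := measure_mono_null hs h0
  simp only [mergeLaw, Measure.pi_pi, Finset.prod_eq_zero_iff, Finset.mem_univ, true_and] at h1
  obtain ⟨i, j, hij⟩ := h1
  by_cases hi : i = Fin.last q ∧ (j : ℕ) < t
  · obtain ⟨rfl, hj⟩ := hi
    rw [if_pos (M.introduced_last_iff.2 hj)] at hij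
    refine gaussianReal_Ioc_pos (M.a_lt_b (Fin.cast M.l_error j))
      (measure_mono_null (t := s (Fin.last q) j) (fun x hx _ _ k hk => ?_) hij)
    have : k = Fin.cast M.l_error j := Fin.ext hk
    rw [this]
    exact hx
  · have : s i j = Set.univ := Set.eq_univ_of_forall fun x h2 h3 => (hi ⟨h2, h3⟩).elim
    rw [this, measure_univ] at hij
    exact one_ne_zero hij

/-! ### Measurability of the alteration -/

theorem mem_nullSpace_iff {t : ℕ} {e : Fin (q + 1)} {z : M.State}
    {v : EuclideanSpace ℝ (Fin (M.l e))} : v ∈ M.nullSpace t e z ↔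
      (∀ j, ¬ M.Introduced t e j → v j = 0) ∧
      ∃ (β : Fin p → ℝ) (s : Fin (q + 1) → ℝ), ∀ k : Fin n, (k : ℕ) < t →
        ∑ j, M.V e k j * v j =
          ∑ c, M.X k c * β c + ∑ i ∈ Finset.univ.erase e, s i * ∑ j, M.V i k j * z i j :=
  Iff.rfl

theorem proj_eq (t : ℕ) (e : Fin (q + 1)) (z : M.State) (v : EuclideanSpace ℝ (Fin (M.l e))) :
    M.proj t e z v = (M.nullSpace t e z).starProjection v := rfl

theorem alterVec_apply (t : ℕ) (e : Fin (q + 1)) (z : M.State) (g : Fin (M.l e) → ℝ)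
    (j : Fin (M.l e)) : M.alterVec t e z g j = M.proj t e z (WithLp.toLp 2 g) j +
      ‖WithLp.toLp 2 g - M.proj t e z (WithLp.toLp 2 g)‖ *
        (‖WithLp.toLp 2 (z e) - M.proj t e z (WithLp.toLp 2 (z e))‖⁻¹ *
          (z e j - M.proj t e z (WithLp.toLp 2 (z e)) j)) := rfl

attribute [local irreducible] nullSpace proj alterVec

theorem norm_sub_proj_lt_iff {t : ℕ} {e : Fin (q + 1)} {z : M.State}
    {g : EuclideanSpace ℝ (Fin (M.l e))} {c : ℝ} :
    ‖g - M.proj t e z g‖ < c ↔ ∃ v ∈ M.nullSpace t e z, ‖g - v‖ < c := by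
  constructor
  · exact fun h => ⟨_, by rw [proj_eq]; exact (M.nullSpace t e z).starProjection_apply_mem g, h⟩
  · rintro ⟨v, hv, h⟩
    refine lt_of_le_of_lt ?_ h
    rw [proj_eq, Submodule.starProjection_minimal]
    exact ciInf_le ⟨0, Set.forall_mem_range.2 fun _ => norm_nonneg _⟩
      (⟨v, hv⟩ : M.nullSpace t e z)

/-- The null space can change dimension with `z`, so continuity is unavailable. Its distance to a
vector is below `c` exactly when some `(v, β, s)` satisfies closed conditions and one strict
inequality. -/
theorem measurable_norm_sub_proj (t : ℕ) (e : Fin (q + 1)) :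
    Measurable fun x : M.State × EuclideanSpace ℝ (Fin (M.l e)) =>
      ‖x.2 - M.proj t e x.1 x.2‖ := by
  refine measurable_of_Iio fun c => ?_
  have hA : IsClosed {x : (M.State × EuclideanSpace ℝ (Fin (M.l e))) ×
      (EuclideanSpace ℝ (Fin (M.l e)) × (Fin p → ℝ) × (Fin (q + 1) → ℝ)) |
      (∀ j, ¬ M.Introduced t e j → x.2.1 j = 0) ∧ ∀ k : Fin n, (k : ℕ) < t →
      ∑ j, M.V e k j * x.2.1 j = ∑ c, M.X k c * x.2.2.1 c +
        ∑ i ∈ Finset.univ.erase e, x.2.2.2 i * ∑ j, M.V i k j * x.1.1 i j} := by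
    refine IsClosed.and ?_ ?_
    · simp only [Set.ofPred_forall]
      exact isClosed_iInter fun j => isClosed_iInter fun _ => isClosed_eq (by fun_prop) (by fun_prop)
    · simp only [Set.ofPred_forall]
      exact isClosed_iInter fun k => isClosed_iInter fun _ => isClosed_eq (by fun_prop) (by fun_prop)
  have h := measurableSet_exists_mem_and_pos hA (ι := Unit) (u := fun _ x => c - ‖x.1.2 - x.2.1‖)
    fun _ => by fun_prop
  convert h using 1
  ext x
  simp only [Set.mem_preimage, Set.mem_Iio, norm_sub_proj_lt_iff, mem_nullSpace_iff, Set.mem_ofPred_eq, sub_pos,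
    forall_const]
  constructor
  · rintro ⟨v, ⟨hv, β, s, h⟩, hc⟩
    exact ⟨(v, β, s), ⟨hv, h⟩, hc⟩
  · rintro ⟨⟨v, β, s⟩, ⟨hv, h⟩, hc⟩
    exact ⟨v, ⟨hv, β, s, h⟩, hc⟩

theorem norm_proj_sq (t : ℕ) (e : Fin (q + 1)) (z : M.State)
    (g : EuclideanSpace ℝ (Fin (M.l e))) :
    ‖M.proj t e z g‖ ^ 2 = ‖g‖ ^ 2 - ‖g - M.proj t e z g‖ ^ 2 := by
  have h := Submodule.norm_sq_eq_add_norm_sq_starProjection g (M.nullSpace t e z)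
  rw [Submodule.starProjection_orthogonal_val] at h
  simp only [proj_eq]
  linarith

theorem measurable_proj_apply (t : ℕ) (e : Fin (q + 1)) (j : Fin (M.l e)) :
    Measurable fun x : M.State × EuclideanSpace ℝ (Fin (M.l e)) => M.proj t e x.1 x.2 j := by
  have hn : Measurable fun x : M.State × EuclideanSpace ℝ (Fin (M.l e)) =>
      ‖M.proj t e x.1 x.2‖ ^ 2 := by
    simp only [norm_proj_sq]
    have := M.measurable_norm_sub_proj t e
    fun_prop
  set u : EuclideanSpace ℝ (Fin (M.l e)) := EuclideanSpace.single j 1 with hu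
  -- Polarization recovers the coordinate `⟪Π g, Π u⟫` from norms of projections, which are
  -- measurable by Pythagoras.
  have h : ∀ x : M.State × EuclideanSpace ℝ (Fin (M.l e)), M.proj t e x.1 x.2 j =
      (‖M.proj t e x.1 (x.2 + u)‖ ^ 2 - ‖M.proj t e x.1 (x.2 - u)‖ ^ 2) / 4 := by
    intro x
    have h1 : inner ℝ (M.proj t e x.1 x.2) (M.proj t e x.1 u) = M.proj t e x.1 x.2 j := by
      simp only [proj_eq]
      rw [← Submodule.inner_starProjection_left_eq_right, Submodule.starProjection_eq_self_iff.2
        (Submodule.starProjection_apply_mem _ _), hu, EuclideanSpace.inner_single_right]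
      simp
    have h2 : M.proj t e x.1 (x.2 + u) = M.proj t e x.1 x.2 + M.proj t e x.1 u := by simp [proj_eq]
    have h3 : M.proj t e x.1 (x.2 - u) = M.proj t e x.1 x.2 - M.proj t e x.1 u := by simp [proj_eq]
    rw [h2, h3, norm_add_sq_real, norm_sub_sq_real, h1]
    ring
  have hp : Measurable fun x : M.State × EuclideanSpace ℝ (Fin (M.l e)) => (x.1, x.2 + u) :=
    measurable_fst.prodMk (measurable_snd.add_const u)
  have hm : Measurable fun x : M.State × EuclideanSpace ℝ (Fin (M.l e)) => (x.1, x.2 - u) :=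
    measurable_fst.prodMk (measurable_snd.sub_const u)
  simp only [h]
  exact ((hn.comp hp).sub (hn.comp hm)).div_const 4

theorem measurable_alterVec (t : ℕ) (e : Fin (q + 1)) :
    Measurable fun x : M.State × (Fin (M.l e) → ℝ) => M.alterVec t e x.1 x.2 := by
  have hG : Measurable fun x : M.State × (Fin (M.l e) → ℝ) =>
      ((x.1, WithLp.toLp 2 x.2) : M.State × EuclideanSpace ℝ (Fin (M.l e))) :=
    measurable_fst.prodMk ((WithLp.measurable_toLp 2 _).comp measurable_snd)
  have hZ : Measurable fun x : M.State × (Fin (M.l e) → ℝ) =>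
      ((x.1, WithLp.toLp 2 (x.1 e)) : M.State × EuclideanSpace ℝ (Fin (M.l e))) :=
    measurable_fst.prodMk
      ((WithLp.measurable_toLp 2 _).comp ((measurable_pi_apply e).comp measurable_fst))
  have h1 := (M.measurable_norm_sub_proj t e).comp hG
  have h2 := (M.measurable_norm_sub_proj t e).comp hZ
  refine measurable_pi_lambda _ fun j => ?_
  have h3 := (M.measurable_proj_apply t e j).comp hG
  have h4 := (M.measurable_proj_apply t e j).comp hZ
  have h5 : Measurable fun x : M.State × (Fin (M.l e) → ℝ) => x.1 e j :=
    (measurable_pi_apply j).comp ((measurable_pi_apply e).comp measurable_fst)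
  simp only [alterVec_apply]
  exact h3.add (h1.mul (h2.inv.mul (h5.sub h4)))

theorem measurable_update (e : Fin (q + 1)) :
    Measurable fun x : M.State × (Fin (M.l e) → ℝ) => Function.update x.1 e x.2 := by
  have : Continuous fun x : M.State × (Fin (M.l e) → ℝ) => Function.update x.1 e x.2 := by fun_prop
  exact this.measurable

theorem measurable_update_alterVec (t : ℕ) (e : Fin (q + 1)) :
    Measurable (Function.uncurry fun (z : M.State) g =>
      Function.update z e (M.alterVec t e z g)) :=
  (M.measurable_update e).comp (measurable_fst.prodMk (M.measurable_alterVec t e))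

theorem measurable_alterEffect (t : ℕ) (e : Fin (q + 1)) : Measurable (M.alterEffect t e) :=
  measurable_measure_map_const (M.measurable_update_alterVec t e)

instance (t : ℕ) (e : Fin (q + 1)) (z : M.State) : IsProbabilityMeasure (M.alterEffect t e z) :=
  Measure.isProbabilityMeasure_map
    ((M.measurable_update_alterVec t e).comp measurable_prodMk_left).aemeasurable

/-! ### Invariance of the target -/

/-- The null space involves only the other effects, so it stays the same while effect `e` is
altered. -/
theorem nullSpace_update (t : ℕ) (e : Fin (q + 1)) (z : M.State) (y : Fin (M.l e) → ℝ) :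
    M.nullSpace t e (Function.update z e y) = M.nullSpace t e z := by
  ext v
  have h : ∀ (s : Fin (q + 1) → ℝ) (k : Fin n),
      ∑ i ∈ Finset.univ.erase e, s i * ∑ j, M.V i k j * Function.update z e y i j =
      ∑ i ∈ Finset.univ.erase e, s i * ∑ j, M.V i k j * z i j := fun s k =>
    Finset.sum_congr rfl fun i hi => by rw [Function.update_of_ne (Finset.ne_of_mem_erase hi)]
  simp only [mem_nullSpace_iff, h]

theorem fit_update (θ : M.Param) (z : M.State) (e : Fin (q + 1)) (y : Fin (M.l e) → ℝ) (k : Fin n) :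
    M.fit θ (Function.update z e y) k = ∑ c, M.X k c * θ.1 c +
      (∑ i ∈ Finset.univ.erase e, θ.2 i * ∑ j, M.V i k j * z i j +
        θ.2 e * ∑ j, M.V e k j * y j) := by
  unfold fit
  rw [← Finset.sum_erase_add _ _ (Finset.mem_univ e)]
  simp only [Function.update_self]
  congr 2
  exact Finset.sum_congr rfl fun i hi => by rw [Function.update_of_ne (Finset.ne_of_mem_erase hi)]

theorem update_mem_C_of_eq_smul_add {t : ℕ} {e : Fin (q + 1)} {z : M.State}
    {y y' v : EuclideanSpace ℝ (Fin (M.l e))} {c : ℝ} (hc : c ≠ 0) (hv : v ∈ M.nullSpace t e z)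
    (h : y' = c • y + v) (hy : Function.update z e (WithLp.ofLp y) ∈ M.C t) :
    Function.update z e (WithLp.ofLp y') ∈ M.C t := by
  obtain ⟨θ, hθ⟩ := hy
  obtain ⟨-, β, s, hs⟩ := M.mem_nullSpace_iff.1 hv
  -- Since `d * V y' = θ.2 e * V y + d * V v`, the coefficient of effect `e` becomes `d`, and the
  -- surplus `d * V v`, a combination of `X` and the other effects, is subtracted from their
  -- coefficients.
  set d := θ.2 e / c with hd
  refine ⟨(fun i => θ.1 i - d * β i, Function.update (fun i => θ.2 i - d * s i) e d),
    fun k hk => ?_⟩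
  have h1 : ∑ j, M.V e k j * y' j = c * ∑ j, M.V e k j * y j + ∑ j, M.V e k j * v j := by
    rw [h, Finset.mul_sum, ← Finset.sum_add_distrib]
    refine Finset.sum_congr rfl fun j _ => ?_
    simp only [PiLp.add_apply, PiLp.smul_apply, smul_eq_mul]
    ring
  have h2 : ∑ i ∈ Finset.univ.erase e, Function.update (fun i => θ.2 i - d * s i) e d i *
      ∑ j, M.V i k j * z i j = ∑ i ∈ Finset.univ.erase e, θ.2 i * ∑ j, M.V i k j * z i j -
      d * ∑ i ∈ Finset.univ.erase e, s i * ∑ j, M.V i k j * z i j := by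
    rw [Finset.mul_sum, ← Finset.sum_sub_distrib]
    refine Finset.sum_congr rfl fun i hi => ?_
    rw [Function.update_of_ne (Finset.ne_of_mem_erase hi)]
    ring
  have h3 : ∑ c, M.X k c * (θ.1 c - d * β c) = ∑ c, M.X k c * θ.1 c - d * ∑ c, M.X k c * β c := by
    rw [Finset.mul_sum, ← Finset.sum_sub_distrib]
    exact Finset.sum_congr rfl fun i _ => by ring
  have hdc : d * c = θ.2 e := by rw [hd]; field_simp
  have h4 : M.fit (fun i => θ.1 i - d * β i, Function.update (fun i => θ.2 i - d * s i) e d)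
      (Function.update z e (WithLp.ofLp y')) k =
      M.fit θ (Function.update z e (WithLp.ofLp y)) k := by
    rw [fit_update, fit_update]
    simp only [Function.update_self]
    rw [h1, h2, h3, hs k hk, ← hdc]
    ring
  rw [h4]
  exact hθ k hk

/-- The projection onto the components of one effect that occur in the first `t` data. -/
noncomputable def coordProj (t : ℕ) (e : Fin (q + 1)) :
    EuclideanSpace ℝ (Fin (M.l e)) →L[ℝ] EuclideanSpace ℝ (Fin (M.l e)) :=
  LinearMap.toContinuousLinearMap
    { toFun := fun x => WithLp.toLp 2 fun j => if M.Introduced t e j then x j else 0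
      map_add' := fun x y => by ext j; by_cases h : M.Introduced t e j <;> simp [h]
      map_smul' := fun c x => by ext j; by_cases h : M.Introduced t e j <;> simp [h] }

theorem coordProj_apply (t : ℕ) (e : Fin (q + 1)) (x : EuclideanSpace ℝ (Fin (M.l e)))
    (j : Fin (M.l e)) : M.coordProj t e x j = if M.Introduced t e j then x j else 0 := rfl

theorem inner_coordProj_left (t : ℕ) (e : Fin (q + 1)) (x y : EuclideanSpace ℝ (Fin (M.l e))) :
    inner ℝ (M.coordProj t e x) y = inner ℝ x (M.coordProj t e y) := by
  simp only [PiLp.inner_apply, coordProj_apply]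
  refine Finset.sum_congr rfl fun j _ => ?_
  split_ifs <;> simp

theorem coordProj_coordProj (t : ℕ) (e : Fin (q + 1)) (x : EuclideanSpace ℝ (Fin (M.l e))) :
    M.coordProj t e (M.coordProj t e x) = M.coordProj t e x := by
  ext j
  simp only [coordProj_apply]
  split_ifs <;> rfl

theorem coordProj_of_mem_nullSpace {t : ℕ} {e : Fin (q + 1)} {z : M.State}
    {v : EuclideanSpace ℝ (Fin (M.l e))} (hv : v ∈ M.nullSpace t e z) : M.coordProj t e v = v := by
  ext j
  rw [coordProj_apply]
  split_ifs with h
  · rfl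
  · exact ((M.mem_nullSpace_iff.1 hv).1 j h).symm

theorem proj_mem_nullSpace (t : ℕ) (e : Fin (q + 1)) (z : M.State)
    (x : EuclideanSpace ℝ (Fin (M.l e))) : M.proj t e z x ∈ M.nullSpace t e z := by
  rw [proj_eq]
  exact Submodule.starProjection_apply_mem _ x

theorem inner_proj_left (t : ℕ) (e : Fin (q + 1)) (z : M.State)
    (x y : EuclideanSpace ℝ (Fin (M.l e))) :
    inner ℝ (M.proj t e z x) y = inner ℝ x (M.proj t e z y) := by
  rw [proj_eq, proj_eq, Submodule.inner_starProjection_left_eq_right]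

theorem proj_coordProj (t : ℕ) (e : Fin (q + 1)) (z : M.State)
    (x : EuclideanSpace ℝ (Fin (M.l e))) : M.proj t e z (M.coordProj t e x) = M.proj t e z x := by
  refine ext_inner_right ℝ fun y => ?_
  rw [inner_proj_left, inner_coordProj_left,
    M.coordProj_of_mem_nullSpace (M.proj_mem_nullSpace t e z y), inner_proj_left]

theorem measurable_coordProj (t : ℕ) (e : Fin (q + 1)) : Measurable (M.coordProj t e) :=
  (M.coordProj t e).continuous.measurable

theorem measurable_ofLp_coordProj (t : ℕ) (e : Fin (q + 1)) :
    Measurable fun x => WithLp.ofLp (M.coordProj t e x) :=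
  (WithLp.measurable_ofLp 2 _).comp (M.measurable_coordProj t e)

theorem proj_update (t : ℕ) (e : Fin (q + 1)) (z : M.State) (y : Fin (M.l e) → ℝ)
    (w : EuclideanSpace ℝ (Fin (M.l e))) :
    M.proj t e (Function.update z e y) w = M.proj t e z w := by
  simp only [proj_eq, nullSpace_update]

theorem map_coordProj_stdGaussian (t : ℕ) (e : Fin (q + 1)) :
    (stdGaussian (EuclideanSpace ℝ (Fin (M.l e)))).map
      (fun x => WithLp.ofLp (M.coordProj t e x)) = M.gaussEffect t e := by
  have hi : ∀ j, IsProbabilityMeasure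
      ((gaussianReal 0 1).map (fun y => if M.Introduced t e j then y else 0)) := fun j => by
    rw [map_ite_gaussianReal]
    infer_instance
  rw [← map_pi_eq_stdGaussian, Measure.map_map (M.measurable_ofLp_coordProj t e) (by fun_prop),
    gaussEffect]
  have h : (fun x => WithLp.ofLp (M.coordProj t e x)) ∘ WithLp.toLp 2 =
      fun (x : Fin (M.l e) → ℝ) j => if M.Introduced t e j then x j else 0 := rfl
  rw [h, Measure.pi_map_pi (f := fun j y => if M.Introduced t e j then y else 0) fun j => by
      split_ifs <;> fun_prop]
  simp only [map_ite_gaussianReal]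

theorem alterVec_update_coordProj (t : ℕ) (e : Fin (q + 1)) (z : M.State)
    (x y : EuclideanSpace ℝ (Fin (M.l e))) :
    M.alterVec t e (Function.update z e (WithLp.ofLp (M.coordProj t e x)))
      (WithLp.ofLp (M.coordProj t e y)) =
    WithLp.ofLp ((M.nullSpace t e z).starProjection y +
      ‖(M.coordProj t e - (M.nullSpace t e z).starProjection) y‖ •
        unitDir (M.coordProj t e - (M.nullSpace t e z).starProjection) x) := by
  ext j
  simp only [alterVec_apply, proj_update, Function.update_self, WithLp.toLp_ofLp, proj_coordProj,
    unitDir, PiLp.add_apply, PiLp.smul_apply, PiLp.sub_apply, smul_eq_mul, sub_apply]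
  simp only [proj_eq]

theorem measurable_update_left (e : Fin (q + 1)) (z : M.State) :
    Measurable fun y : Fin (M.l e) → ℝ => Function.update z e y :=
  (M.measurable_update e).comp measurable_prodMk_left

theorem measurable_alterVec_update (t : ℕ) (e : Fin (q + 1)) (z : M.State) :
    Measurable fun x : (Fin (M.l e) → ℝ) × (Fin (M.l e) → ℝ) =>
      M.alterVec t e (Function.update z e x.1) x.2 :=
  (M.measurable_alterVec t e).comp
    (((M.measurable_update_left e z).comp measurable_fst).prodMk measurable_snd)

theorem map_alterVec_update (t : ℕ) (e : Fin (q + 1)) (z : M.State) :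
    ((M.gaussEffect t e).prod (M.gaussEffect t e)).map
      (fun x => M.alterVec t e (Function.update z e x.1) x.2) = M.gaussEffect t e := by
  have hm := M.measurable_alterVec_update t e z
  have hU := measurable_unitDir (M.coordProj t e - (M.nullSpace t e z).starProjection)
  have hP := M.measurable_ofLp_coordProj t e
  have hP' := M.measurable_coordProj t e
  have h := map_projection_add_norm_smul_unitDir (M.inner_coordProj_left t e)
    (M.coordProj_coordProj t e) (Submodule.inner_starProjection_left_eq_right (M.nullSpace t e z))
    (fun x => Submodule.starProjection_eq_self_iff.2 (Submodule.starProjection_apply_mem _ x))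
    (fun x => M.coordProj_of_mem_nullSpace (Submodule.starProjection_apply_mem _ x))
  have h' := congrArg (fun μ => μ.map WithLp.ofLp) h
  rw [Measure.map_map (by fun_prop) (by fun_prop), Measure.map_map (by fun_prop) (by fun_prop)] at h'
  nth_rw 3 [← M.map_coordProj_stdGaussian t e]
  refine Eq.trans ?_ h'
  nth_rw 1 2 [← M.map_coordProj_stdGaussian t e]
  rw [Measure.map_prod_map _ _ hP hP, Measure.map_map hm (hP.prodMap hP)]
  congr 1
  funext x
  exact M.alterVec_update_coordProj t e z x.1 x.2

/-- Modulo the null space, the old vector is `D x.1` and the new one `‖D x.2‖ / ‖D x.1‖` times it;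
the equivalence applies `update_mem_C_of_eq_smul_add` both ways. -/
theorem ae_update_alterVec_mem_C_iff (t : ℕ) (e : Fin (q + 1)) (z : M.State) :
    ∀ᵐ x ∂(M.gaussEffect t e).prod (M.gaussEffect t e),
      Function.update z e x.1 ∈ M.C t ↔
        Function.update z e (M.alterVec t e (Function.update z e x.1) x.2) ∈ M.C t := by
  have hm := M.measurable_alterVec_update t e z
  have hu := M.measurable_update_left e z
  have hP' := M.measurable_ofLp_coordProj t e
  have hC := M.measurableSet_C t
  have hset : MeasurableSet {x : (Fin (M.l e) → ℝ) × (Fin (M.l e) → ℝ) |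
      Function.update z e x.1 ∈ M.C t ↔
        Function.update z e (M.alterVec t e (Function.update z e x.1) x.2) ∈ M.C t} :=
    MeasurableSet.iff ((hu.comp measurable_fst) hC) ((hu.comp hm) hC)
  rw [← M.map_coordProj_stdGaussian t e, Measure.map_prod_map _ _ hP' hP',
    ae_map_iff (hP'.prodMap hP').aemeasurable hset]
  set A := (M.nullSpace t e z).starProjection with hA
  set D := M.coordProj t e - A with hD
  have hAm : ∀ x, A x ∈ M.nullSpace t e z := fun x => Submodule.starProjection_apply_mem _ x
  simp only [Prod.map, alterVec_update_coordProj]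
  have hP : ∀ x, M.coordProj t e x = A x + D x := fun x => by simp [hD]
  have key : ∀ᵐ x ∂(stdGaussian (EuclideanSpace ℝ (Fin (M.l e)))).prod
      (stdGaussian (EuclideanSpace ℝ (Fin (M.l e)))), (D x.1 = 0 ↔ D x.2 = 0) := by
    -- Either `D` vanishes identically or it is almost surely nonzero at both Gaussian vectors; this
    -- keeps the scaling factor nonzero.
    by_cases h0 : ∃ u, D u ≠ 0
    · obtain ⟨u, hu⟩ := h0
      have hne : ∀ᵐ x ∂stdGaussian (EuclideanSpace ℝ (Fin (M.l e))), D x ≠ 0 := by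
        filter_upwards [ae_stdGaussian_inner_ne_zero hu] with x hx h0
        refine hx ?_
        have : inner ℝ (D u) x = inner ℝ u (D x) := by
          simp only [hD, sub_apply, inner_sub_left, inner_sub_right,
            inner_coordProj_left]
          rw [hA, Submodule.inner_starProjection_left_eq_right]
        rw [this, h0, inner_zero_right]
      have h1 := Measure.quasiMeasurePreserving_fst
        (μ := stdGaussian (EuclideanSpace ℝ (Fin (M.l e))))
        (ν := stdGaussian (EuclideanSpace ℝ (Fin (M.l e)))) |>.ae hne
      have h2 := Measure.quasiMeasurePreserving_snd
        (μ := stdGaussian (EuclideanSpace ℝ (Fin (M.l e))))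
        (ν := stdGaussian (EuclideanSpace ℝ (Fin (M.l e)))) |>.ae hne
      filter_upwards [h1, h2] with x hx1 hx2
      simp [hx1, hx2]
    · push Not at h0
      simp [h0]
  filter_upwards [key] with x hx
  obtain ⟨c, hc, h⟩ : ∃ c : ℝ, c ≠ 0 ∧ ‖D x.2‖ • unitDir D x.1 = c • D x.1 := by
    by_cases h1 : D x.1 = 0
    · exact ⟨1, one_ne_zero, by simp [unitDir, h1]⟩
    · have h2 : D x.2 ≠ 0 := fun h => h1 (hx.2 h)
      exact ⟨‖D x.2‖ * ‖D x.1‖⁻¹, by positivity, by rw [unitDir, smul_smul]⟩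
  rw [h]
  constructor
  · refine M.update_mem_C_of_eq_smul_add hc (v := A x.2 - c • A x.1)
      (Submodule.sub_mem _ (hAm _) (Submodule.smul_mem _ _ (hAm _))) ?_
    rw [hP, smul_add]
    abel
  · refine M.update_mem_C_of_eq_smul_add (inv_ne_zero hc) (v := A x.1 - c⁻¹ • A x.2)
      (Submodule.sub_mem _ (hAm _) (Submodule.smul_mem _ _ (hAm _))) ?_
    rw [hP, smul_add, smul_smul, inv_mul_cancel₀ hc, one_smul]
    abel

/-- With the other effects fixed, the old and new vectors of effect `e` are both Gaussian, and
almost surely one is in `C t` if and only if the other is. Thus starting in `C t` and landing in `B`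
has the Gaussian probability of `C t ∩ B`; integrating over the other effects gives invariance. -/
theorem unnormTarget_bind_alterEffect (t : ℕ) (e : Fin (q + 1)) :
    (M.unnormTarget t).bind (M.alterEffect t e) = M.unnormTarget t := by
  ext B hB
  have hC := M.measurableSet_C t
  have hCB := hC.inter hB
  have hup := M.measurable_update e
  set μ := M.gaussEffect t e with hμ
  have hF := M.measurable_update_alterVec t e
  set Γ := M.mergeLaw (M.Introduced t) 0 with hΓ
  have hΓe : (Γ.prod μ).map (fun x => Function.update x.1 e x.2) = Γ :=
    Measure.pi_prod_map_update (fun i => M.gaussEffect t i) e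
  have hcoe : Measurable fun z => M.alterEffect t e z B :=
    (Measure.measurable_coe hB).comp (M.measurable_alterEffect t e)
  have hav := M.measurable_alterVec_update t e
  have hu := M.measurable_update_left e
  have key : ∀ z : M.State, ∫⁻ y, (M.C t).indicator (fun z => M.alterEffect t e z B)
      (Function.update z e y) ∂μ = μ {y | Function.update z e y ∈ M.C t ∩ B} := by
    intro z
    have h1 : MeasurableSet {x : (Fin (M.l e) → ℝ) × (Fin (M.l e) → ℝ) |
        Function.update z e x.1 ∈ M.C t ∧
          Function.update z e (M.alterVec t e (Function.update z e x.1) x.2) ∈ B} :=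
      (((hu z).comp measurable_fst) hC).inter (((hu z).comp (hav z)) hB)
    have h2 : ∀ y, (M.C t).indicator (fun z => M.alterEffect t e z B) (Function.update z e y) =
        μ (Prod.mk y ⁻¹' {x : (Fin (M.l e) → ℝ) × (Fin (M.l e) → ℝ) |
        Function.update z e x.1 ∈ M.C t ∧
          Function.update z e (M.alterVec t e (Function.update z e x.1) x.2) ∈ B}) := by
      intro y
      by_cases hy : Function.update z e y ∈ M.C t
      · have hFy : Measurable fun g => Function.update (Function.update z e y) e
            (M.alterVec t e (Function.update z e y) g) :=
          hF.comp (measurable_prodMk_left (x := Function.update z e y))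
        rw [Set.indicator_of_mem hy, alterEffect, Measure.map_apply hFy hB]
        simp only [Set.preimage_ofPred_eq, hy, true_and, Function.update_idem]
        rfl
      · simp [hy]
    simp only [h2]
    rw [← Measure.prod_apply h1]
    have h3 : MeasurableSet {y | Function.update z e y ∈ M.C t ∩ B} := (hu z) hCB
    conv_rhs => rw [hμ, ← M.map_alterVec_update t e z, Measure.map_apply (hav z) h3]
    refine measure_congr ?_
    filter_upwards [M.ae_update_alterVec_mem_C_iff t e z] with x hx
    exact propext (and_congr_left' hx)
  rw [Measure.bind_apply hB (M.measurable_alterEffect t e).aemeasurable, unnormTarget,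
    Measure.restrict_apply hB, ← lintegral_indicator hC, Set.inter_comm]
  conv_lhs => rw [← hΓ, ← hΓe]
  have hcu : Measurable fun x : M.State × (Fin (M.l e) → ℝ) =>
      (M.C t).indicator (fun z => M.alterEffect t e z B) (Function.update x.1 e x.2) :=
    (hcoe.indicator hC).comp hup
  rw [lintegral_map (hcoe.indicator hC) hup, lintegral_prod _ hcu.aemeasurable]
  simp only [key]
  conv_rhs => rw [← hΓ, ← hΓe, Measure.map_apply hup hCB, Measure.prod_apply (hup hCB)]
  rfl

/-- The initial kernel is general so that the induction can absorb the effects already altered. -/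
theorem foldl_bind_alterEffect (t : ℕ) (L : List (Fin (q + 1))) {κ : M.State → Measure M.State}
    (hκ : Measurable κ) (hp : ∀ z, IsProbabilityMeasure (κ z))
    (h : (M.unnormTarget t).bind κ = M.unnormTarget t) :
    Measurable (fun z => L.foldl (fun μ e => μ.bind (M.alterEffect t e)) (κ z)) ∧
    (∀ z, IsProbabilityMeasure (L.foldl (fun μ e => μ.bind (M.alterEffect t e)) (κ z))) ∧
    (M.unnormTarget t).bind (fun z => L.foldl (fun μ e => μ.bind (M.alterEffect t e)) (κ z)) =
      M.unnormTarget t := by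
  induction L generalizing κ with
  | nil => exact ⟨hκ, hp, h⟩
  | cons e L ih =>
    have hm := M.measurable_alterEffect t e
    refine ih ((Measure.measurable_bind' hm).comp hκ) (fun z => ?_) ?_
    · exact isProbabilityMeasure_bind hm.aemeasurable (ae_of_all _ fun _ => inferInstance)
    · rw [← Measure.bind_bind hκ.aemeasurable hm.aemeasurable, h, unnormTarget_bind_alterEffect]

theorem measurable_alter (t : ℕ) : Measurable (M.alter t) :=
  (M.foldl_bind_alterEffect t _ Measure.measurable_dirac (fun _ => inferInstance)
    Measure.bind_dirac).1

instance (t : ℕ) (z : M.State) : IsProbabilityMeasure (M.alter t z) :=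
  (M.foldl_bind_alterEffect t _ Measure.measurable_dirac (fun _ => inferInstance)
    Measure.bind_dirac).2.1 z

theorem unnormTarget_bind_alter (t : ℕ) :
    (M.unnormTarget t).bind (M.alter t) = M.unnormTarget t :=
  (M.foldl_bind_alterEffect t _ Measure.measurable_dirac (fun _ => inferInstance)
    Measure.bind_dirac).2.2

/-! ### Consistency of the algorithm by induction on time -/

theorem sampleStep_eq_moveStep (k : Fin n) {N : ℕ} :
    M.sampleStep k (N := N) = moveStep (M.proposal k) (M.weightFactor k) := rfl

theorem resampleStep_eq_resampleMoveStep (S : Set ℕ) (T : ℝ) (t : ℕ) {N : ℕ} :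
    M.resampleStep S T t (N := N) = resampleMoveStep (M.alter t)
      fun s => totalWeight s ≠ 0 ∧ (t ∈ S ∨ (ess s : ℝ) < T) := by
  have h : M.alterStep t (N := N) = moveStep (M.alter t) fun _ => 1 := by
    funext s
    simp only [alterStep, moveStep, mul_one]
  funext s
  unfold resampleStep resampleMoveStep
  rw [h]
  congr!

theorem measurableSet_resampling (S : Set ℕ) (T : ℝ) (t : ℕ) {N : ℕ} :
    MeasurableSet {s : M.Particles N | totalWeight s ≠ 0 ∧ (t ∈ S ∨ (ess s : ℝ) < T)} := by
  have h1 : Measurable fun s : M.Particles N => totalWeight s := by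
    unfold totalWeight
    fun_prop
  have h2 : Measurable fun s : M.Particles N => (ess s : ℝ) := by
    unfold ess
    fun_prop
  exact (h1 (measurableSet_singleton 0)).compl.inter
    ((MeasurableSet.const _).union (h2 measurableSet_Iio))

theorem unnormTarget_zero : M.unnormTarget 0 = Measure.dirac 0 := by
  have h : M.C 0 = Set.univ := Set.eq_univ_of_forall fun z => ⟨0, fun k hk => by omega⟩
  have h' : ∀ i j, ¬ M.Introduced 0 i j := fun i j ⟨k, hk, _⟩ => by omega
  rw [unnormTarget, h, Measure.restrict_univ, mergeLaw_eq_map]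
  have : M.merge (M.Introduced 0) 0 = fun _ => 0 := by
    funext g i j
    simp [merge, h']
  rw [this, Measure.map_const, measure_univ, one_smul]

theorem isConsistent_dirac : IsConsistent (Measure.dirac (0 : M.State))
    fun N => Measure.dirac fun _ : Fin N => ((0 : M.State), (1 : ℝ≥0)) := by
  refine ⟨fun N => inferInstance, ⟨1, fun N => ?_⟩, ⟨1, one_pos, ?_⟩, ?_⟩
  · rw [ae_dirac_iff]
    · exact fun _ => le_rfl
    · simp only [Set.ofPred_forall]
      exact MeasurableSet.iInter fun J => measurableSet_le (by fun_prop) measurable_const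
  · refine tendsto_const_nhds.congr fun N => ?_
    rw [Measure.dirac_apply' _ (measurableSet_total_weight_lt _), Set.indicator_of_notMem]
    simp
  · rintro g hg - h0 ε hε
    rw [integral_dirac' _ _ hg.stronglyMeasurable] at h0
    refine tendsto_const_nhds.congr' ?_
    -- For `N = 0` the event reads `0 ≤ 0` and has full mass.
    filter_upwards [eventually_gt_atTop 0] with N hN
    rw [Measure.dirac_apply' _ (measurableSet_le_abs_weighted_sum hg _), Set.indicator_of_notMem]
    simp only [Set.mem_ofPred_eq, h0, zero_mul, Finset.sum_const_zero, abs_zero, not_le]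
    positivity

theorem isConsistent_smcLaw (S : Set ℕ) (T : ℕ → ℕ → ℝ) {t : ℕ} (ht : t ≤ n) :
    IsConsistent (M.unnormTarget t) fun N => M.smcLaw S T N t := by
  induction t with
  | zero =>
    rw [unnormTarget_zero]
    exact M.isConsistent_dirac
  | succ t ih =>
    have h : t < n := ht
    have h1 := (ih h.le).move (M.measurable_proposal ⟨t, h⟩) (M.measurable_weightFactor ⟨t, h⟩)
      (M.weightFactor_le ⟨t, h⟩) (M.weightConst_pos ⟨t, h⟩) (M.unnormTarget_ne_zero (t + 1))
      fun g hg hb => M.integral_proposal ⟨t, h⟩ hg hb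
    have h2 := h1.resampleMove (M.measurable_alter (t + 1)) (M.unnormTarget_bind_alter (t + 1))
      (fun N => M.measurableSet_resampling S (T (t + 1) N) (t + 1)) fun N s hs => hs.1
    simpa only [smcLaw, dif_pos h, sampleStep_eq_moveStep, resampleStep_eq_resampleMoveStep] using h2

end IntervalLMM

theorem theorem1 {n p q : ℕ} (M : IntervalLMM n p q) (S : Set ℕ) (T : ℕ → ℕ → ℝ)
    (f : M.State → ℝ) (hf : Measurable f) (hb : ∃ B : ℝ, ∀ z, |f z| ≤ B) :
    IsProbabilityMeasure (M.target n) ∧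
    (∀ N : ℕ, IsProbabilityMeasure (M.smcLaw S T N n)) ∧
    ∀ ε : ℝ, 0 < ε →
      Tendsto
        (fun N : ℕ => M.smcLaw S T N n
          {s | ε ≤ |IntervalLMM.weightedAverage f s - ∫ z, f z ∂(M.target n)|})
        atTop (𝓝 0) := by
  have h0 := M.unnormTarget_ne_zero n
  have hc := M.isConsistent_smcLaw S T le_rfl
  refine ⟨?_, hc.prob, fun ε hε => ?_⟩
  · refine cond_isProbabilityMeasure fun h => h0 ?_
    rw [IntervalLMM.unnormTarget, Measure.restrict_eq_zero, ← M.pi_gaussEffect_eq_mergeLaw, h]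
  · have h := hc.tendsto_weighted_average h0 hf hb hε
    rw [M.target_eq_smul, integral_smul_measure, ENNReal.toReal_inv, smul_eq_mul]
    exact h
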